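/- Setting. Nodes $0,1,\dots,m$ form a chain. At each time step $i\in\{1,\dots,n\}$ every node $j<m$ sends one bit to node $j+1$ through a binary symmetric channel with crossover probability $p$; all channel uses are independent. Node $0$ knows a message $w\in\{0,1\}^k$; for $1\le j\le m-1$ the bit sent by node $j$ at time $i$ depends only on what it received before time $i$; after $n$ steps node $m$ outputs an estimate $\hat w$ of $w$. Block code. To $b$ blocks of equal length, $\lceil\log_2 b\rceil+1$ redundancy blocks are appended bit by bit: for $b\ge 3$ by the systematic Hamming code shortened to $b$ data bits (unneeded redundancy blocks are zero), with syndrome decoding, so that any one corrupted block is corrected; for $b\le 2$ by one block equal to the sum modulo $2$ of the data blocks and otherwise zero blocks, and then the data blocks are read off without correction. Recursive code. Put $t_l=(l+2)^2$, $b_l=\lfloor (l+2)^2/4\rfloor$, $T_l=\prod_{i=1}^l t_i$, $k_l=\prod_{i=1}^l b_i$, $n_l=\prod_{i=1}^l(b_i+\lceil\log_2 b_i\rceil+1)$. Level-$0$ encoding and decoding is the identity on one bit. The level-$l$ encoder cuts $k_l$ bits into $b_l$ blocks of length $k_{l-1}$, appends redundancy blocks by the block code, and encodes every block at level $l-1$,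 giving $n_l$ bits. The level-$l$ decoder cuts $n_l$ bits into $b_l+\lceil\log_2 b_l\rceil+1$ blocks, decodes each at level $l-1$, and then applies the decoder of the block code. Protocol with $r$ repetitions. The level of a relay node $j\in\{1,\dots,m-1\}$ is the largest $l$ with $T_l\mid j$. Let $L'$ be the largest level of a relay node, let $L$ be given by $k_L\le k<k_{L+1}$, and put $D=\max\{L,L'\}$. Node $0$ pads $w$ with zeros, cuts it into $\lceil k/k_D\rceil$ blocks of $k_D$ bits, encodes each at level $D$, and sends the resulting $N=\lceil k/k_D\rceil\, n_D$ bits one after the other. A level-$l$ relay node reads successive blocks of $n_l$ bits, decodes each at level $l$, encodes the result again at level $l$, and sends the $n_l$ bits; it starts to send as soon as its first block of $n_l$ bits has arrived, and ignores what it receives before its predecessor has started to send. Node $m$ decodes each block of $n_D$ bits at level $D$ and drops the padding. Throughout, every bit is sent $r$ times in a row and the receiver replaces each group of $r$ received bits by their majority vote. The total transmission time is $n=r\big(\sum_{j=1}^{m-1}n_{l(j)}+N\big)$, where $l(j)$ is the level of node $j$. Claim. For every fixed $p\in(0,\tfrac12)$ there is an integer $r\ge 1$ such that, in the limit $m\to\infty$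 with $k=\Theta(m)$, this protocol has total transmission time $n=\mathcal O(m)$ and error probability at most $\exp\!\big(-n^{\Theta(1/\log\log n)}\big)$. That is, for all $0<\alpha\le\beta$ there are $C,c>0$ and $M$ such that for all $m\ge M$, all $k$ with $\alpha m\le k\le\beta m$, and every message $w\in\{0,1\}^k$ (hence also for a random message), $$n\le C\,m\qquad\text{and}\qquad \Pr[\hat w\ne w]\le\exp\!\big(-n^{\,c/\log\log n}\big).$$ -/

import Mathlib

namespace ManyHop

/-! ## Relaying over a chain of binary symmetric channels -/

/-- A deterministic protocol sending a `k`-bit message from node `0` to node `m` in `n` time steps.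
Times are numbered `0, …, n - 1`.  Node `0` sends `encode w i` at time `i`; a node `j ≥ 1` sends at
time `i` the bit `relay j i h`, where `h` holds exactly the `i` bits that it received at the
times `0, …, i - 1`; the last node forms its estimate from the `n` bits that it received. -/
structure Protocol (k n : ℕ) where
  encode : (Fin k → Bool) → ℕ → Bool
  relay : ℕ → (i : ℕ) → (Fin i → Bool) → Bool
  decode : (Fin n → Bool) → Fin k → Bool

/-- The bit `X_{i,j}` that node `j` sends to node `j + 1` at time `i`, when the message is `w` and
`z j i` is the noise bit (`true` for a flip) of the channel from `j` to `j + 1` at time `i`. -/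
def Protocol.sent {k n : ℕ} (P : Protocol k n) (w : Fin k → Bool) (z : ℕ → ℕ → Bool) :
    ℕ → ℕ → Bool
  | 0, i => P.encode w i
  | j + 1, i => P.relay (j + 1) i fun s => Bool.xor (P.sent w z j s) (z j s)

/-- The bit `Y_{i,j}` that node `j + 1` receives from node `j` at time `i`. -/
def Protocol.received {k n : ℕ} (P : Protocol k n) (w : Fin k → Bool) (z : ℕ → ℕ → Bool)
    (j i : ℕ) : Bool :=
  Bool.xor (P.sent w z j i) (z j i)

/-- The estimate of the message formed by node `m`. -/
def Protocol.estimate {k n : ℕ} (P : Protocol k n) (m : ℕ) (w : Fin k → Bool)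
    (z : ℕ → ℕ → Bool) : Fin k → Bool :=
  P.decode fun i => P.received w z (m - 1) i

/-- Noise bits of `m` channels over `n` time steps, as a doubly indexed family (the values outside
the range are never used). -/
def extendNoise {m n : ℕ} (z : Fin m × Fin n → Bool) (j i : ℕ) : Bool :=
  if h : j < m ∧ i < n then z (⟨j, h.1⟩, ⟨i, h.2⟩) else false

/-- The law of the noise: all bits are independent and equal `true` with probability `p`. -/
noncomputable def noiseLaw (p : unitInterval) (m n : ℕ) :
    MeasureTheory.Measure (Fin m × Fin n → Bool) :=
  MeasureTheory.Measure.pi fun _ => ProbabilityTheory.bernoulliMeasure true false p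

/-- The probability that node `m` does not recover the message `w`. -/
noncomputable def Protocol.errorProb {k n : ℕ} (P : Protocol k n) (p : unitInterval) (m : ℕ)
    (w : Fin k → Bool) : ℝ :=
  (noiseLaw p m n).real {z | P.estimate m w (extendNoise z) ≠ w}

/-! ## The block code: shortened Hamming codes -/

/-- The number `⌈log₂ b⌉ + 1` of redundancy symbols added to `b` symbols. -/
def redundancy (b : ℕ) : ℕ := Nat.clog 2 b + 1

/-- The label of the `j`-th data position (`j = 0, 1, …`): the `j`-th positive integer that is not
a power of two, i.e. `3, 5, 6, 7, 9, …`. -/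
noncomputable def dataLabel (j : ℕ) : ℕ := Nat.nth (fun x => 0 < x ∧ ∀ i : ℕ, x ≠ 2 ^ i) j

/-- The label of a position of a codeword: data positions come first, and the `i`-th redundancy
position has label `2 ^ i`.  The binary digits of the labels are the columns of the
parity-check matrix. -/
noncomputable def label (b a : ℕ) : ℕ := if a < b then dataLabel a else 2 ^ (a - b)

/-- The sum modulo 2, over the positions `a < N` whose label has a digit `1` in place `i`, of the
bits `y a`. -/
noncomputable def parityCheck (b N : ℕ) (y : ℕ → Bool) (i : ℕ) : Bool :=
  decide (Odd (((Finset.range N).filter fun a => y a = true ∧ (label b a).testBit i = true).card))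

/-- Encoding of `b` bits into `b + redundancy b` bits.  For `b ≥ 3` this is the systematic
Hamming code, shortened to `b` data bits; if it needs fewer than `redundancy b` redundant bits, the
remaining ones are zero.  For `b ≤ 2` there is one redundant bit, the sum modulo 2 of the data bits,
and the remaining ones are zero. -/
noncomputable def blockEncode (b : ℕ) (d : ℕ → Bool) (a : ℕ) : Bool :=
  if a < b then d a
  else if b ≤ 2 then
    decide (a = b ∧ Odd (((Finset.range b).filter fun j => d j = true).card))
  else parityCheck b b d (a - b)

/-- Decoding, on the assumption that at most one of the `b + redundancy b` bits was changed.  For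
`b ≥ 3` the data bit `j` is flipped exactly if the syndrome is its label.  For `b ≤ 2` the
redundancy does not allow for a correction, and the data bits are taken as they are. -/
noncomputable def blockDecode (b : ℕ) (y : ℕ → Bool) (j : ℕ) : Bool :=
  if b ≤ 2 then y j
  else Bool.xor (y j)
    (decide (∀ i < redundancy b,
      parityCheck b (b + redundancy b) y i = (label b j).testBit i))

/-! ## The recursive code -/

/-- `t_l = (l + 2)²`. -/
def tSeq (l : ℕ) : ℕ := (l + 2) ^ 2

/-- `b_l = ⌊(l + 2)² / 4⌋`. -/
def bSeq (l : ℕ) : ℕ := (l + 2) ^ 2 / 4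

/-- `T_l = t_1 ⋯ t_l`. -/
def tProd (l : ℕ) : ℕ := ∏ i ∈ Finset.Icc 1 l, tSeq i

/-- `k_l = b_1 ⋯ b_l`, the number of message bits of a level-`l` block. -/
def msgLen (l : ℕ) : ℕ := ∏ i ∈ Finset.Icc 1 l, bSeq i

/-- `n_l = ∏_{i ≤ l} (b_i + ⌈log₂ b_i⌉ + 1)`, the number of coded bits of a level-`l` block. -/
def codeLen (l : ℕ) : ℕ := ∏ i ∈ Finset.Icc 1 l, (bSeq i + redundancy (bSeq i))

/-- The level-`l` encoder.  It maps `k_l` bits (the values at `0, …, k_l - 1`) to `n_l` bits.  At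
level `l + 1` the input is cut into `b_{l+1}` blocks of `k_l` bits, redundancy blocks are
appended bit by bit, and each block is encoded at level `l`. -/
noncomputable def levelEncode : ℕ → (ℕ → Bool) → ℕ → Bool
  | 0, x => x
  | l + 1, x => fun q =>
      levelEncode l
        (fun s => blockEncode (bSeq (l + 1)) (fun j => x (j * msgLen l + s)) (q / codeLen l))
        (q % codeLen l)

/-- The level-`l` decoder.  It maps `n_l` bits to `k_l` bits.  At level `l + 1` the input is cut
into `b_{l+1} + ⌈log₂ b_{l+1}⌉ + 1` blocks of `n_l` bits, each is decoded at level `l`, and the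
results are decoded bit by bit. -/
noncomputable def levelDecode : ℕ → (ℕ → Bool) → ℕ → Bool
  | 0, y => y
  | l + 1, y => fun s =>
      blockDecode (bSeq (l + 1))
        (fun a => levelDecode l (fun q => y (a * codeLen l + q)) (s % msgLen l))
        (s / msgLen l)

/-! ## The multi-hop protocol -/

/-- The level of a node `j ≥ 1`: the largest `l` such that `T_l` divides `j`. -/
def level (j : ℕ) : ℕ := Nat.findGreatest (fun l => tProd l ∣ j) j

/-- `L'`: the largest level of a relay node `1, …, m - 1`. -/
def maxRelayLevel (m : ℕ) : ℕ := (Finset.Icc 1 (m - 1)).sup level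

/-- `L`: the level with `k_L ≤ k < k_{L+1}`. -/
def msgLevel (k : ℕ) : ℕ := Nat.findGreatest (fun l => msgLen l ≤ k) k

/-- `max {L, L'}`: the level at which node `0` encodes and node `m` decodes. -/
def endLevel (m k : ℕ) : ℕ := max (msgLevel k) (maxRelayLevel m)

/-- The number `⌈k / k_D⌉` of blocks, `D = endLevel m k`, into which the zero-padded message is
cut (one block if `0 < k < k_{L'}`). -/
def numBlocks (m k : ℕ) : ℕ := (k + msgLen (endLevel m k) - 1) / msgLen (endLevel m k)

/-- The number of bits sent by every node, before repetition. -/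
def streamLen (m k : ℕ) : ℕ := numBlocks m k * codeLen (endLevel m k)

/-- The time at which node `j` starts to send, when each bit is repeated `r` times: a relay node of
level `l` first waits for `r * n_l` bits. -/
def startTime (r j : ℕ) : ℕ := ∑ i ∈ Finset.Icc 1 j, r * codeLen (level i)

/-- The total transmission time: the last node starts to receive when node `m - 1` starts to
send. -/
def transmissionTime (r m k : ℕ) : ℕ := startTime r (m - 1) + r * streamLen m k

/-- Majority vote over the bits `f 0, …, f (r - 1)`. -/
def majority (r : ℕ) (f : ℕ → Bool) : Bool :=
  decide (r < 2 * ((Finset.range r).filter fun e => f e = true).card)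

/-- The bits obtained from the received sequence `y` by ignoring what comes before time `s` and
taking a majority vote over each group of `r` consecutive bits from then on. -/
def votes (r s : ℕ) (y : ℕ → Bool) (q : ℕ) : Bool := majority r fun e => y (s + r * q + e)

/-- The bit stream sent by the encoder (before repetition): the message, padded with
zeros, encoded block by block at level `endLevel m k`. -/
noncomputable def sourceStream (m k : ℕ) (w : Fin k → Bool) (q : ℕ) : Bool :=
  levelEncode (endLevel m k)
    (fun s =>
      let x := q / codeLen (endLevel m k) * msgLen (endLevel m k) + s
      if h : x < k then w ⟨x, h⟩ else false)
    (q % codeLen (endLevel m k))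

/-- What a relay node of level `l` makes of the bit stream `u`: each block of `n_l` bits is decoded
and encoded again. -/
noncomputable def relayStream (l : ℕ) (u : ℕ → Bool) (q : ℕ) : Bool :=
  levelEncode l (levelDecode l fun s => u (q / codeLen l * codeLen l + s)) (q % codeLen l)

/-- A bit stream `u` of length `N`, sent from time `s` on with each bit repeated `r` times; zeros
are sent at all other times. -/
def transmit (r N s : ℕ) (u : ℕ → Bool) (i : ℕ) : Bool :=
  if s ≤ i ∧ i < s + r * N then u ((i - s) / r) else false

/-- The multi-bit protocol over `m` hops with `r` repetitions. -/
noncomputable def multiBit (r m k : ℕ) : Protocol k (transmissionTime r m k) where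
  encode w := transmit r (streamLen m k) 0 (sourceStream m k w)
  relay j i h :=
    transmit r (streamLen m k) (startTime r j)
      (relayStream (level j)
        (votes r (startTime r (j - 1)) fun s => if hs : s < i then h ⟨s, hs⟩ else false)) i
  decode y x :=
    let D := endLevel m k
    let u := votes r (startTime r (m - 1)) fun s =>
      if hs : s < transmissionTime r m k then y ⟨s, hs⟩ else false
    levelDecode D (fun q => u (x / msgLen D * codeLen D + q)) (x % msgLen D)

end ManyHop

/-!
A node of level `l` decodes and re-encodes level-`l` blocks, and between two consecutive multiples
of `T_{l+1}` there are fewer than `t_{l+1}` nodes of level at least `l`, at distance `T_l`. Call a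
level-`0` block failed if the majority vote on it is wrong, and a level-`(l + 1)` block failed on
its `T_{l+1}` hops if at least two of its sub-blocks fail on some of the `t_{l+1}` segments of
`T_l` hops (at least one for `l = 0`, where the block code does not correct errors). By induction
on `l`, a block that does not fail reaches every node on its way in decodable form. Distinct blocks
use disjoint sets of channel uses, so that their failures are independent and the failure
probabilities satisfy `δ_{l+1} ≤ (b_{l+1} + ⌈log₂ b_{l+1}⌉ + 1)² t_{l+1}² δ_l²` for `l ≥ 1`. This
recursion gives `δ_l ≤ exp(-2^l)` as soon as `δ_1` is small, which enough repetitions ensure by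
Hoeffding's inequality.

The rate stays bounded below because the redundancy of the `l`-th block code is a fraction
`O(log l / l²)` of its length, and the delays sum up to at most `∑_l (m / T_l) n_l ≤ 2m` because
`2^l n_l ≤ T_l`. Finally `n ≤ T_{D+1}²` is at most `(D + 3)^(4 (D + 3))`, that is, the level `D` is
of order at least `log n / log log n`, which turns `exp(-2^D)` into the claimed bound.
-/

namespace ManyHop

open MeasureTheory ProbabilityTheory

/-! ## The block code -/

theorem infinite_pos_ne_two_pow : {x : ℕ | 0 < x ∧ ∀ i : ℕ, x ≠ 2 ^ i}.Infinite := by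
  refine Set.infinite_of_injective_forall_mem (f := fun n : ℕ => 2 * n + 3)
    (fun a b h => by simpa using h) fun n => ?_
  refine ⟨by omega, fun i h => ?_⟩
  rcases i with _ | i
  · simp at h
  · rw [pow_succ] at h
    omega

theorem dataLabel_mem (j : ℕ) : 0 < dataLabel j ∧ ∀ i : ℕ, dataLabel j ≠ 2 ^ i :=
  Nat.nth_mem_of_infinite infinite_pos_ne_two_pow j

theorem dataLabel_injective : Function.Injective dataLabel :=
  Nat.nth_injective infinite_pos_ne_two_pow

theorem two_pow_le_count_add (R : ℕ) [DecidablePred fun x : ℕ => 0 < x ∧ ∀ i : ℕ, x ≠ 2 ^ i] :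
    2 ^ R ≤ Nat.count (fun x : ℕ => 0 < x ∧ ∀ i : ℕ, x ≠ 2 ^ i) (2 ^ R) + (R + 1) := by
  rw [Nat.count_eq_card_filter_range]
  set A := (Finset.range (2 ^ R)).filter fun x : ℕ => 0 < x ∧ ∀ i : ℕ, x ≠ 2 ^ i
  have range_subset : Finset.range (2 ^ R) ⊆
      A ∪ insert 0 ((Finset.range R).image fun i => 2 ^ i) := by
    intro x hx
    by_cases h : x ∈ A
    · exact Finset.mem_union_left _ h
    · refine Finset.mem_union_right _ ?_
      simp only [A, Finset.mem_filter, hx, true_and, not_and, not_forall, not_not] at h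
      rcases Nat.eq_zero_or_pos x with rfl | x_pos
      · exact Finset.mem_insert_self _ _
      · obtain ⟨i, rfl⟩ := h x_pos
        have hi : i < R := (Nat.pow_lt_pow_iff_right (by norm_num)).1 (Finset.mem_range.1 hx)
        exact Finset.mem_insert_of_mem (Finset.mem_image_of_mem _ (Finset.mem_range.2 hi))
  calc 2 ^ R = (Finset.range (2 ^ R)).card := (Finset.card_range _).symm
    _ ≤ A.card + (insert 0 ((Finset.range R).image fun i => 2 ^ i)).card :=
      (Finset.card_le_card range_subset).trans (Finset.card_union_le _ _)
    _ ≤ A.card + (R + 1) := by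
      gcongr
      refine (Finset.card_insert_le _ _).trans ?_
      gcongr
      exact Finset.card_image_le.trans (Finset.card_range R).le

theorem dataLabel_lt {b j : ℕ} (hb : 3 ≤ b) (hj : j < b) : dataLabel j < 2 ^ redundancy b := by
  classical
  refine Nat.nth_lt_of_lt_count ?_
  have le_pow : b ≤ 2 ^ Nat.clog 2 b := Nat.le_pow_clog one_lt_two b
  have two_le : 2 ≤ Nat.clog 2 b := (Nat.lt_clog_iff_pow_lt one_lt_two).2 (by omega)
  have add_two_le (c : ℕ) (hc : 2 ≤ c) : c + 2 ≤ 2 ^ c := by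
    induction c, hc using Nat.le_induction with
    | base => norm_num
    | succ c _ ih => rw [pow_succ]; omega
  have := add_two_le _ two_le
  have := two_pow_le_count_add (redundancy b)
  have : 2 ^ redundancy b = 2 * 2 ^ Nat.clog 2 b := pow_succ' ..
  have : redundancy b = Nat.clog 2 b + 1 := rfl
  omega

theorem label_of_lt {b a : ℕ} (h : a < b) : label b a = dataLabel a := if_pos h

theorem label_add (b i : ℕ) : label b (b + i) = 2 ^ i := by
  rw [label, if_neg (by omega), Nat.add_sub_cancel_left]

theorem label_lt {b a : ℕ} (hb : 3 ≤ b) (ha : a < b + redundancy b) :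
    label b a < 2 ^ redundancy b := by
  by_cases h : a < b
  · rw [label_of_lt h]
    exact dataLabel_lt hb h
  · obtain ⟨i, rfl⟩ := Nat.exists_eq_add_of_le (not_lt.1 h)
    rw [label_add]
    exact Nat.pow_lt_pow_right one_lt_two (by omega)

theorem label_eq_label_iff {b a j : ℕ} (hj : j < b) : label b a = label b j ↔ a = j := by
  refine ⟨fun h => ?_, congrArg _⟩
  rw [label_of_lt hj] at h
  by_cases ha : a < b
  · rw [label_of_lt ha] at h
    exact dataLabel_injective h
  · rw [label, if_neg ha] at h
    exact absurd h.symm ((dataLabel_mem j).2 _)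

theorem forall_lt_testBit_eq_iff {R u v : ℕ} (hu : u < 2 ^ R) (hv : v < 2 ^ R) :
    (∀ i < R, u.testBit i = v.testBit i) ↔ u = v := by
  refine ⟨fun h => Nat.eq_of_testBit_eq fun i => ?_, fun h i _ => h ▸ rfl⟩
  by_cases hi : i < R
  · exact h i hi
  · have two_pow_le : 2 ^ R ≤ 2 ^ i := Nat.pow_le_pow_right two_pos (not_lt.1 hi)
    rw [Nat.testBit_lt_two_pow (hu.trans_le two_pow_le),
      Nat.testBit_lt_two_pow (hv.trans_le two_pow_le)]

theorem parityCheck_zero (b : ℕ) (y : ℕ → Bool) (i : ℕ) : parityCheck b 0 y i = false := by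
  simp [parityCheck]

theorem parityCheck_succ (b N : ℕ) (y : ℕ → Bool) (i : ℕ) :
    parityCheck b (N + 1) y i = (parityCheck b N y i ^^ (y N && (label b N).testBit i)) := by
  unfold parityCheck
  rw [Finset.range_add_one, Finset.filter_insert]
  split_ifs with h
  · rw [Finset.card_insert_of_notMem (by simp)]
    simp [Nat.odd_add_one, h, -Nat.not_odd_iff_even]
  · simp [Bool.eq_false_iff.2 (mt (Bool.and_eq_true _ _).mp h)]

theorem parityCheck_congr {b N : ℕ} {y y' : ℕ → Bool} (h : ∀ a < N, y a = y' a) (i : ℕ) :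
    parityCheck b N y i = parityCheck b N y' i := by
  induction N with
  | zero => simp only [parityCheck_zero]
  | succ N ih =>
    rw [parityCheck_succ, parityCheck_succ, ih fun a ha => h a (by omega), h N (by omega)]

theorem parityCheck_xor (b N : ℕ) (y e : ℕ → Bool) (i : ℕ) :
    parityCheck b N (fun a => y a ^^ e a) i = (parityCheck b N y i ^^ parityCheck b N e i) := by
  induction N with
  | zero => simp only [parityCheck_zero, Bool.xor_false]
  | succ N ih => grind [parityCheck_succ]

theorem parityCheck_single (b N a₀ : ℕ) (e : Bool) (i : ℕ) :
    parityCheck b N (fun a => e && decide (a = a₀)) i =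
      (e && decide (a₀ < N) && (label b a₀).testBit i) := by
  induction N with
  | zero => simp [parityCheck_zero]
  | succ N ih => grind [parityCheck_succ]

theorem blockEncode_of_lt {b a : ℕ} (d : ℕ → Bool) (h : a < b) : blockEncode b d a = d a :=
  if_pos h

theorem parityCheck_add (b n : ℕ) (y : ℕ → Bool) (i : ℕ) :
    parityCheck b (b + n) y i = (parityCheck b b y i ^^ (decide (i < n) && y (b + i))) := by
  induction n with
  | zero => simp
  | succ n ih =>
    rw [← add_assoc, parityCheck_succ, ih, label_add, Nat.testBit_two_pow]
    grind

theorem syndrome_blockEncode {b i : ℕ} (hb : 3 ≤ b) (d : ℕ → Bool) (hi : i < redundancy b) :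
    parityCheck b (b + redundancy b) (blockEncode b d) i = false := by
  rw [parityCheck_add, parityCheck_congr fun a ha => blockEncode_of_lt d ha]
  simp [hi, blockEncode, show ¬ b ≤ 2 by omega]

theorem syndrome_eq_label_iff {b j a₀ : ℕ} (hb : 3 ≤ b) (d : ℕ → Bool) (e : Bool)
    (ha₀ : a₀ < b + redundancy b) (hj : j < b) :
    (∀ i < redundancy b, parityCheck b (b + redundancy b)
      (fun a => blockEncode b d a ^^ (e && decide (a = a₀))) i = (label b j).testBit i) ↔
      (e && decide (j = a₀)) := by
  have syndrome_eq : ∀ i < redundancy b, parityCheck b (b + redundancy b)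
      (fun a => blockEncode b d a ^^ (e && decide (a = a₀))) i =
        (if e then label b a₀ else 0).testBit i := fun i hi => by
    rw [parityCheck_xor, syndrome_blockEncode hb d hi, parityCheck_single]
    cases e <;> simp [ha₀]
  have label_pos : 0 < label b j := label_of_lt hj ▸ (dataLabel_mem j).1
  rw [forall₂_congr fun i hi => by rw [syndrome_eq i hi], forall_lt_testBit_eq_iff
    (by split_ifs; exacts [label_lt hb ha₀, by positivity]) (label_lt hb (by omega))]
  cases e
  · simpa using label_pos.ne
  · simpa [eq_comm] using label_eq_label_iff hj

theorem blockDecode_of_eq_off {b j a₀ : ℕ} (hb : 3 ≤ b) (d y : ℕ → Bool)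
    (ha₀ : a₀ < b + redundancy b)
    (h : ∀ a < b + redundancy b, a ≠ a₀ → y a = blockEncode b d a) (hj : j < b) :
    blockDecode b y j = d j := by
  obtain ⟨e, he⟩ : ∃ e, y a₀ = (blockEncode b d a₀ ^^ e) :=
    ⟨blockEncode b d a₀ ^^ y a₀, by simp⟩
  have y_eq : ∀ a < b + redundancy b, y a = (blockEncode b d a ^^ (e && decide (a = a₀))) := by
    intro a ha
    by_cases haa : a = a₀
    · simp [haa, he]
    · simp [haa, h a ha haa]
  simp only [blockDecode, if_neg (show ¬ b ≤ 2 by omega), parityCheck_congr y_eq,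
    syndrome_eq_label_iff hb d e ha₀ hj, y_eq j (by omega), blockEncode_of_lt d hj]
  simp

/-- The number of corrupted symbols from which on decoding of the block code may fail. -/
def errorThreshold (b : ℕ) : ℕ := if b ≤ 2 then 1 else 2

theorem blockDecode_of_card_lt {b j : ℕ} (d y : ℕ → Bool) (G : ℕ → Prop) [DecidablePred G]
    (h : ∀ a < b + redundancy b, ¬ G a → y a = blockEncode b d a)
    (hG : ((Finset.range (b + redundancy b)).filter G).card < errorThreshold b) (hj : j < b) :
    blockDecode b y j = d j := by
  unfold errorThreshold at hG
  split_ifs at hG with hb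
  · have not_G : ¬ G j := fun hg => by
      rw [Nat.lt_one_iff, Finset.card_eq_zero] at hG
      exact Finset.filter_eq_empty_iff.1 hG (Finset.mem_range.2 (by omega)) hg
    rw [blockDecode, if_pos hb, h j (by omega) not_G, blockEncode_of_lt d hj]
  · have G_unique := Finset.card_le_one.1 (Nat.lt_succ_iff.1 hG)
    by_cases he : ∃ a₀ < b + redundancy b, G a₀
    · obtain ⟨a₀, ha₀, hg⟩ := he
      refine blockDecode_of_eq_off (by omega) d y ha₀ (fun a ha hne => h a ha fun hga => hne ?_) hj
      exact G_unique a (by simp [ha, hga]) a₀ (by simp [ha₀, hg])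
    · push Not at he
      exact blockDecode_of_eq_off (a₀ := 0) (by omega) d y (by omega)
        (fun a ha _ => h a ha (he a ha)) hj

theorem blockEncode_congr {b : ℕ} {d d' : ℕ → Bool} (h : ∀ j < b, d j = d' j) (a : ℕ) :
    blockEncode b d a = blockEncode b d' a := by
  have filter_eq : (Finset.range b).filter (fun j => d j = true) =
      (Finset.range b).filter fun j => d' j = true :=
    Finset.filter_congr fun j hj => by rw [h j (Finset.mem_range.1 hj)]
  unfold blockEncode
  rw [filter_eq, parityCheck_congr h]
  split_ifs with ha
  exacts [h a ha, rfl, rfl]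

theorem blockDecode_congr {b j : ℕ} {y y' : ℕ → Bool}
    (h : ∀ a < b + redundancy b, y a = y' a) (hj : j < b) :
    blockDecode b y j = blockDecode b y' j := by
  unfold blockDecode
  simp_rw [h j (by omega), parityCheck_congr h]

/-! ## The recursive code -/

/-- The number of level-`(l - 1)` blocks in a level-`l` block. -/
def numSub (l : ℕ) : ℕ := bSeq l + redundancy (bSeq l)

theorem tProd_succ (l : ℕ) : tProd (l + 1) = tSeq (l + 1) * tProd l := by
  rw [tProd, Finset.prod_Icc_succ_top (by omega), mul_comm]; rfl

theorem msgLen_succ (l : ℕ) : msgLen (l + 1) = bSeq (l + 1) * msgLen l := by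
  rw [msgLen, Finset.prod_Icc_succ_top (by omega), mul_comm]; rfl

theorem codeLen_succ (l : ℕ) : codeLen (l + 1) = numSub (l + 1) * codeLen l := by
  rw [codeLen, Finset.prod_Icc_succ_top (by omega), mul_comm]; rfl

theorem tProd_dvd {l l' : ℕ} (h : l ≤ l') : tProd l ∣ tProd l' :=
  Finset.prod_dvd_prod_of_subset _ _ _ (Finset.Icc_subset_Icc_right h)

theorem msgLen_dvd {l l' : ℕ} (h : l ≤ l') : msgLen l ∣ msgLen l' :=
  Finset.prod_dvd_prod_of_subset _ _ _ (Finset.Icc_subset_Icc_right h)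

theorem codeLen_dvd {l l' : ℕ} (h : l ≤ l') : codeLen l ∣ codeLen l' :=
  Finset.prod_dvd_prod_of_subset _ _ _ (Finset.Icc_subset_Icc_right h)

theorem two_le_bSeq (l : ℕ) : 2 ≤ bSeq (l + 1) := by
  have : 3 ^ 2 ≤ (l + 1 + 2) ^ 2 := Nat.pow_le_pow_left (by omega) 2
  unfold bSeq
  omega

theorem four_le_bSeq {l : ℕ} (hl : 2 ≤ l) : 4 ≤ bSeq l := by
  have : 4 ^ 2 ≤ (l + 2) ^ 2 := Nat.pow_le_pow_left (by omega) 2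
  unfold bSeq
  omega

theorem redundancy_le {b : ℕ} (hb : 1 ≤ b) : redundancy b ≤ b := by
  have : Nat.clog 2 b ≤ b - 1 := Nat.clog_le_of_le_pow (by have := (b - 1).lt_two_pow_self; omega)
  unfold redundancy
  omega

theorem numSub_pos (l : ℕ) : 0 < numSub l := Nat.add_pos_right _ (Nat.succ_pos _)

theorem two_mul_numSub_le (l : ℕ) : 2 * numSub (l + 1) ≤ tSeq (l + 1) := by
  have := redundancy_le (one_le_two.trans (two_le_bSeq l))
  have : 4 * bSeq (l + 1) ≤ tSeq (l + 1) := Nat.mul_div_le _ _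
  unfold numSub
  omega

theorem codeLen_pos (l : ℕ) : 0 < codeLen l := Finset.prod_pos fun i _ => numSub_pos i

theorem two_pow_le_msgLen (l : ℕ) : 2 ^ l ≤ msgLen l := by
  induction l with
  | zero => simp [msgLen]
  | succ l ih => rw [msgLen_succ, pow_succ']; exact Nat.mul_le_mul (two_le_bSeq l) ih

theorem msgLen_pos (l : ℕ) : 0 < msgLen l := (Nat.two_pow_pos l).trans_le (two_pow_le_msgLen l)

theorem codeLen_mul_two_pow_le (l : ℕ) : codeLen l * 2 ^ l ≤ tProd l := by
  induction l with
  | zero => simp [codeLen, tProd]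
  | succ l ih =>
    rw [codeLen_succ, tProd_succ, pow_succ]
    calc numSub (l + 1) * codeLen l * (2 ^ l * 2)
        = 2 * numSub (l + 1) * (codeLen l * 2 ^ l) := by ring
      _ ≤ tSeq (l + 1) * tProd l := Nat.mul_le_mul (two_mul_numSub_le l) ih

theorem two_pow_le_tProd (l : ℕ) : 2 ^ l ≤ tProd l :=
  (Nat.le_mul_of_pos_left _ (codeLen_pos l)).trans (codeLen_mul_two_pow_le l)

theorem lt_tProd (l : ℕ) : l < tProd l := l.lt_two_pow_self.trans_le (two_pow_le_tProd l)

theorem tProd_pos (l : ℕ) : 0 < tProd l := l.zero_le.trans_lt (lt_tProd l)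

theorem mul_add_div_of_lt {n s : ℕ} (q : ℕ) (hs : s < n) : (q * n + s) / n = q := by
  rw [mul_comm, Nat.mul_add_div (by omega), Nat.div_eq_of_lt hs, add_zero]

theorem mul_add_lt_mul_of_lt {a b n s : ℕ} (ha : a < b) (hs : s < n) : a * n + s < b * n :=
  mul_comm a n ▸ Nat.mul_add_lt_mul_of_lt_of_lt ha hs

theorem levelEncode_congr {l : ℕ} {x x' : ℕ → Bool} (h : ∀ s < msgLen l, x s = x' s) {q : ℕ}
    (hq : q < codeLen l) : levelEncode l x q = levelEncode l x' q := by
  induction l generalizing x x' q with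
  | zero => exact h q hq
  | succ l ih =>
    refine ih (fun s hs => blockEncode_congr (fun j hj => h _ ?_) _) (Nat.mod_lt _ (codeLen_pos l))
    rw [msgLen_succ]
    exact mul_add_lt_mul_of_lt hj hs

theorem levelDecode_congr {l : ℕ} {y y' : ℕ → Bool} (h : ∀ q < codeLen l, y q = y' q) {s : ℕ}
    (hs : s < msgLen l) : levelDecode l y s = levelDecode l y' s := by
  induction l generalizing y y' s with
  | zero => exact h s hs
  | succ l ih =>
    rw [msgLen_succ] at hs
    refine blockDecode_congr (fun a ha => ih (fun q hq => h (a * codeLen l + q) ?_)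
      (Nat.mod_lt _ (msgLen_pos l))) (Nat.div_lt_of_lt_mul (by rwa [mul_comm]))
    rw [codeLen_succ]
    exact mul_add_lt_mul_of_lt ha hq

/-- The `q`-th level-`l` block of the stream `u` is the encoding of the message `x`. -/
def IsEncodedBlock (l : ℕ) (u : ℕ → Bool) (q : ℕ) (x : ℕ → Bool) : Prop :=
  ∀ s < codeLen l, u (q * codeLen l + s) = levelEncode l x s

/-- The `q`-th level-`l` block of the stream `u` is decoded to the message `x`, though it may
contain errors. -/
def IsDecodedBlock (l : ℕ) (u : ℕ → Bool) (q : ℕ) (x : ℕ → Bool) : Prop :=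
  ∀ s < msgLen l, levelDecode l (fun s => u (q * codeLen l + s)) s = x s

/-- The `a`-th of the level-`l` messages that the level-`(l + 1)` encoder makes of `x`. -/
noncomputable def subMessage (l : ℕ) (x : ℕ → Bool) (a s : ℕ) : Bool :=
  blockEncode (bSeq (l + 1)) (fun j => x (j * msgLen l + s)) a

theorem IsEncodedBlock.subblock {l q a : ℕ} {u x : ℕ → Bool} (h : IsEncodedBlock (l + 1) u q x)
    (ha : a < numSub (l + 1)) :
    IsEncodedBlock l u (q * numSub (l + 1) + a) (subMessage l x a) := by
  intro s hs
  have index_eq : (q * numSub (l + 1) + a) * codeLen l + s =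
      q * codeLen (l + 1) + (a * codeLen l + s) := by
    rw [codeLen_succ]; ring
  rw [index_eq, h _ (by rw [codeLen_succ]; exact mul_add_lt_mul_of_lt ha hs)]
  simp only [levelEncode, mul_add_div_of_lt a hs, Nat.mul_add_mod_of_lt hs]
  rfl

theorem isDecodedBlock_succ {l q : ℕ} {u x : ℕ → Bool} (G : ℕ → Prop) [DecidablePred G]
    (h : ∀ a < numSub (l + 1), ¬ G a →
      IsDecodedBlock l u (q * numSub (l + 1) + a) (subMessage l x a))
    (hG : ((Finset.range (numSub (l + 1))).filter G).card < errorThreshold (bSeq (l + 1))) :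
    IsDecodedBlock (l + 1) u q x := by
  intro s hs
  rw [msgLen_succ] at hs
  have block_eq : ∀ a < numSub (l + 1), ¬ G a →
      levelDecode l (fun t => u (q * codeLen (l + 1) + (a * codeLen l + t))) (s % msgLen l) =
        subMessage l x a (s % msgLen l) := fun a ha hGa => by
    rw [← h a ha hGa _ (Nat.mod_lt _ (msgLen_pos l)), codeLen_succ]
    simp only [add_mul, mul_assoc, add_assoc]
  calc levelDecode (l + 1) (fun t => u (q * codeLen (l + 1) + t)) s
      = x (s / msgLen l * msgLen l + s % msgLen l) :=
        blockDecode_of_card_lt (fun j => x (j * msgLen l + s % msgLen l)) _ G block_eq hG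
          (Nat.div_lt_of_lt_mul (by rwa [mul_comm]))
    _ = x s := by rw [Nat.div_add_mod']

theorem IsDecodedBlock.relay {l q : ℕ} {u x : ℕ → Bool} (h : IsDecodedBlock l u q x) :
    IsEncodedBlock l (relayStream l u) q x := by
  intro s hs
  rw [relayStream, mul_add_div_of_lt q hs, Nat.mul_add_mod_of_lt hs]
  exact levelEncode_congr h hs

theorem relayStream_congr {l q : ℕ} {u u' : ℕ → Bool}
    (h : ∀ s < codeLen l, u (q / codeLen l * codeLen l + s) = u' (q / codeLen l * codeLen l + s)) :
    relayStream l u q = relayStream l u' q :=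
  levelEncode_congr (fun _ hs => levelDecode_congr h hs) (Nat.mod_lt _ (codeLen_pos l))

/-! ## Levels of nodes -/

theorem tProd_level_dvd (j : ℕ) : tProd (level j) ∣ j :=
  Nat.findGreatest_spec (P := fun l => tProd l ∣ j) (Nat.zero_le j) (by simp [tProd])

theorem le_level {j l : ℕ} (hj : 0 < j) (h : tProd l ∣ j) : l ≤ level j :=
  Nat.le_findGreatest ((lt_tProd l).le.trans (Nat.le_of_dvd hj h)) h

theorem level_eq {j l : ℕ} (hj : 0 < j) (h : tProd l ∣ j) (h' : ¬ tProd (l + 1) ∣ j) :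
    level j = l :=
  le_antisymm (not_lt.1 fun hlt => h' ((tProd_dvd hlt).trans (tProd_level_dvd j))) (le_level hj h)

theorem level_add_mul {j l i : ℕ} (hj : tProd (l + 1) ∣ j) (hi : 0 < i) (hit : i < tSeq (l + 1)) :
    level (j + i * tProd l) = l := by
  refine level_eq (Nat.add_pos_right _ (Nat.mul_pos hi (tProd_pos l)))
    (((tProd_dvd l.le_succ).trans hj).add (dvd_mul_left _ _)) fun hdvd => ?_
  rw [Nat.dvd_add_right hj, tProd_succ] at hdvd
  exact hit.not_ge (Nat.le_of_dvd hi (Nat.dvd_of_mul_dvd_mul_right (tProd_pos l) hdvd))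

theorem level_le_maxRelayLevel {m j : ℕ} (hj : 1 ≤ j) (hjm : j < m) : level j ≤ maxRelayLevel m :=
  Finset.le_sup (f := level) (Finset.mem_Icc.2 ⟨hj, by omega⟩)

theorem level_le_endLevel {m j : ℕ} (k : ℕ) (hj : 1 ≤ j) (hjm : j < m) : level j ≤ endLevel m k :=
  (level_le_maxRelayLevel hj hjm).trans (le_max_right _ _)

theorem le_tProd_of_maxRelayLevel_lt {m l : ℕ} (h : maxRelayLevel m < l) : m ≤ tProd l := by
  by_contra! hlt
  exact h.not_ge ((le_level (tProd_pos l) dvd_rfl).trans (level_le_maxRelayLevel (tProd_pos l) hlt))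

theorem le_tProd_endLevel_succ (m k : ℕ) : m ≤ tProd (endLevel m k + 1) :=
  le_tProd_of_maxRelayLevel_lt (Nat.lt_succ_of_le (le_max_right _ _))

/-! ## Propagation of blocks along the chain -/

section Chain

open Classical in
/-- Failure of the `q`-th level-`l` block on the `T_l` hops from node `j` on, in terms of the
set `E` of wrong votes: too many of its sub-blocks fail on some part of the way.  The hops may reach
beyond the last node. -/
def Fails (E : ℕ → ℕ → Prop) : ℕ → ℕ → ℕ → Prop
  | 0, j, q => E j q
  | l + 1, j, q => errorThreshold (bSeq (l + 1)) ≤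
      ((Finset.range (numSub (l + 1))).filter fun a =>
        ∃ i < tSeq (l + 1), Fails E l (j + i * tProd l) (q * numSub (l + 1) + a)).card

/-- The `q`-th level-`l` block fails on one of the `t` successive segments of `T_l` hops that start
at node `j`. -/
def FailsWithin (E : ℕ → ℕ → Prop) (l t j q : ℕ) : Prop := ∃ i < t, Fails E l (j + i * tProd l) q

/-- A chain of relay nodes where node `j` sends the stream `S j`, node `j + 1` receives `U j`, and
`E` contains all wrong votes. -/
structure IsChain (S U : ℕ → ℕ → Bool) (E : ℕ → ℕ → Prop) : Prop where
  relay (j : ℕ) : S (j + 1) = relayStream (level (j + 1)) (U j)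
  vote {j q : ℕ} : ¬ E j q → U j q = S j q

/-- A level-`l` block that is sent by a node of level at least `l` and does not fail can be decoded
by each of the next `T_l` nodes. -/
def IsReliable (S U : ℕ → ℕ → Bool) (E : ℕ → ℕ → Prop) (l : ℕ) : Prop :=
  ∀ ⦃j q x⦄, tProd l ∣ j → IsEncodedBlock l (S j) q x → ¬ Fails E l j q →
    ∀ d < tProd l, IsDecodedBlock l (U (j + d)) q x

open Classical in
theorem fails_succ_iff {E : ℕ → ℕ → Prop} {l j q : ℕ} :
    Fails E (l + 1) j q ↔ errorThreshold (bSeq (l + 1)) ≤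
      ((Finset.range (numSub (l + 1))).filter fun a =>
        FailsWithin E l (tSeq (l + 1)) j (q * numSub (l + 1) + a)).card := by
  rw [Fails]
  unfold FailsWithin
  convert Iff.rfl

variable {S U : ℕ → ℕ → Bool} {E : ℕ → ℕ → Prop}

theorem IsReliable.isDecodedBlock {l t j q d : ℕ} {x : ℕ → Bool} (h : IsReliable S U E l)
    (hc : IsChain S U E) (hj : tProd l ∣ j) (hx : IsEncodedBlock l (S j) q x)
    (hF : ¬ FailsWithin E l t j q) (hd : d < t * tProd l)
    (hlevel : ∀ i, 0 < i → i * tProd l ≤ d → level (j + i * tProd l) = l) :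
    IsDecodedBlock l (U (j + d)) q x := by
  have dvd_add (i : ℕ) : tProd l ∣ j + i * tProd l := hj.add (dvd_mul_left _ _)
  have not_fails (i : ℕ) (hi : i * tProd l ≤ d) : ¬ Fails E l (j + i * tProd l) q := fun hf =>
    hF ⟨i, lt_of_mul_lt_mul_right (hi.trans_lt hd) (Nat.zero_le _), hf⟩
  have encoded (i : ℕ) (hi : i * tProd l ≤ d) : IsEncodedBlock l (S (j + i * tProd l)) q x := by
    induction i with
    | zero => simpa using hx
    | succ i ih =>
      have hi' : i * tProd l ≤ d := (Nat.mul_le_mul_right _ i.le_succ).trans hi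
      have node_eq : j + (i + 1) * tProd l = j + i * tProd l + (tProd l - 1) + 1 := by
        have := tProd_pos l
        rw [add_one_mul]
        omega
      have level_node := hlevel (i + 1) i.succ_pos hi
      rw [node_eq] at level_node ⊢
      rw [hc.relay, level_node]
      exact (h (dvd_add i) (ih hi') (not_fails i hi') _ (Nat.pred_lt (tProd_pos l).ne')).relay
  have hdiv : d / tProd l * tProd l ≤ d := Nat.div_mul_le_self _ _
  have key := h (dvd_add _) (encoded _ hdiv) (not_fails _ hdiv) _ (Nat.mod_lt d (tProd_pos l))
  rwa [add_assoc, Nat.div_add_mod'] at key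

theorem IsChain.isReliable (hc : IsChain S U E) (l : ℕ) : IsReliable S U E l := by
  induction l with
  | zero =>
    intro j q x _ hx hF d hd s hs
    obtain rfl : d = 0 := Nat.lt_one_iff.1 hd
    obtain rfl : s = 0 := Nat.lt_one_iff.1 hs
    have sent_eq := hx 0 (codeLen_pos 0)
    simp only [codeLen, Finset.Icc_eq_empty_of_lt one_pos, Finset.prod_empty, mul_one, add_zero,
      levelDecode, levelEncode] at sent_eq ⊢
    rw [hc.vote hF, sent_eq]
  | succ l ih =>
    intro j q x hj hx hF d hd
    rw [tProd_succ] at hd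
    rw [fails_succ_iff, not_le] at hF
    classical
    refine isDecodedBlock_succ _ (fun a ha hG => ?_) hF
    refine ih.isDecodedBlock hc ((tProd_dvd l.le_succ).trans hj) (hx.subblock ha) hG hd
      fun i hi hid => level_add_mul hj hi ?_
    exact lt_of_mul_lt_mul_right (hid.trans_lt hd) (Nat.zero_le _)

theorem IsChain.isDecodedBlock_last (hc : IsChain S U E) {m D q : ℕ} {x : ℕ → Bool} (hm : 0 < m)
    (hD : ∀ j, 1 ≤ j → j < m → level j ≤ D) (hmT : m ≤ tProd (D + 1))
    (hx : IsEncodedBlock D (S 0) q x) (hF : ¬ FailsWithin E D (tSeq (D + 1)) 0 q) :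
    IsDecodedBlock D (U (m - 1)) q x := by
  have key := (hc.isReliable D).isDecodedBlock (d := m - 1) hc (dvd_zero _) hx hF
    (by rw [← tProd_succ]; omega) fun i hi hid => ?_
  · rwa [zero_add] at key
  · have node_pos : 0 < 0 + i * tProd D := by have := Nat.mul_pos hi (tProd_pos D); omega
    exact le_antisymm (hD _ node_pos (by omega)) (le_level node_pos (by simp))

end Chain

/-! ## The streams of the protocol -/

/-- The vote on the bit at position `q` of the stream sent by node `j` is wrong (or a tie). -/
def VoteFails (r : ℕ) (z : ℕ → ℕ → Bool) (j q : ℕ) : Prop :=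
  r ≤ 2 * ((Finset.range r).filter fun e => z j (startTime r j + r * q + e) = true).card

/-- The stream of votes of node `j + 1` when node `j` sends the stream `u`. -/
def noisyVotes (r : ℕ) (z : ℕ → ℕ → Bool) (j : ℕ) (u : ℕ → Bool) (q : ℕ) : Bool :=
  majority r fun e => u q ^^ z j (startTime r j + r * q + e)

/-- The stream of bits that node `j` sends, before repetition. -/
noncomputable def nodeStream (r m k : ℕ) (w : Fin k → Bool) (z : ℕ → ℕ → Bool) : ℕ → ℕ → Bool
  | 0 => sourceStream m k w
  | j + 1 => relayStream (level (j + 1)) (noisyVotes r z j (nodeStream r m k w z j))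

theorem majority_congr {r : ℕ} {f g : ℕ → Bool} (h : ∀ e < r, f e = g e) :
    majority r f = majority r g := by
  unfold majority
  rw [Finset.filter_congr fun e he => by rw [h e (Finset.mem_range.1 he)]]

theorem majority_xor {r : ℕ} {f : ℕ → Bool} (b : Bool)
    (h : 2 * ((Finset.range r).filter fun e => f e = true).card < r) :
    majority r (fun e => b ^^ f e) = b := by
  have card_add := Finset.card_filter_add_card_filter_not (s := Finset.range r) fun e => f e = true
  unfold majority
  cases b
  · simp only [Bool.false_xor, decide_eq_false_iff_not]
    omega
  · simp only [Bool.true_xor, Bool.not_eq_true', decide_eq_true_eq, Bool.not_eq_true,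
      Finset.card_range] at card_add ⊢
    omega

theorem isChain_nodeStream (r m k : ℕ) (w : Fin k → Bool) (z : ℕ → ℕ → Bool) :
    IsChain (nodeStream r m k w z) (fun j => noisyVotes r z j (nodeStream r m k w z j))
      (VoteFails r z) where
  relay _ := rfl
  vote h := majority_xor _ (not_le.1 h)

theorem transmit_add {r N s q e : ℕ} (u : ℕ → Bool) (hq : q < N) (he : e < r) :
    transmit r N s u (s + r * q + e) = u q := by
  have index_lt := mul_add_lt_mul_of_lt hq he
  rw [mul_comm q, mul_comm N] at index_lt
  rw [transmit, if_pos ⟨by omega, by omega⟩, add_assoc, Nat.add_sub_cancel_left, mul_comm,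
    mul_add_div_of_lt q he]

theorem startTime_succ (r j : ℕ) :
    startTime r (j + 1) = startTime r j + r * codeLen (level (j + 1)) := by
  rw [startTime, Finset.sum_Icc_succ_top (by omega)]; rfl

theorem sent_eq_nodeStream {r m k : ℕ} (w : Fin k → Bool) (z : ℕ → ℕ → Bool) {j q e : ℕ}
    (hj : j < m) (hq : q < streamLen m k) (he : e < r) :
    (multiBit r m k).sent w z j (startTime r j + r * q + e) = nodeStream r m k w z j q := by
  induction j generalizing q e with
  | zero => exact transmit_add _ hq he
  | succ j ih =>
    set n := codeLen (level (j + 1)) with hn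
    obtain ⟨c, hc⟩ : n ∣ streamLen m k :=
      (codeLen_dvd (level_le_endLevel k (by omega) hj)).mul_left _
    change transmit _ _ _ _ _ = _
    rw [transmit_add _ hq he, nodeStream]
    refine relayStream_congr fun s hs => majority_congr fun e' he' => ?_
    rw [← hn] at hs ⊢
    set p := q / n * n + s
    have p_lt : p < streamLen m k := by
      rw [hc, mul_comm]
      exact mul_add_lt_mul_of_lt (Nat.div_lt_of_lt_mul (hc ▸ hq)) hs
    have p_lt_add : p < q + n := by
      have := Nat.div_mul_le_self q n
      omega
    have received_before : startTime r j + r * p + e' < startTime r (j + 1) + r * q + e := by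
      have : r * p + r ≤ r * q + r * n := by
        rw [← Nat.mul_succ, ← mul_add]
        exact Nat.mul_le_mul_left r p_lt_add
      rw [startTime_succ, ← hn]
      omega
    simp only [Nat.add_sub_cancel, dif_pos received_before, ih (by omega) p_lt he']

theorem votes_received {r m k q : ℕ} (hm : 0 < m) (w : Fin k → Bool) (z : ℕ → ℕ → Bool)
    (hq : q < streamLen m k) :
    votes r (startTime r (m - 1)) (fun i => if i < transmissionTime r m k then
      (multiBit r m k).received w z (m - 1) i else false) q =
        noisyVotes r z (m - 1) (nodeStream r m k w z (m - 1)) q := by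
  refine majority_congr fun e he => ?_
  have in_time : startTime r (m - 1) + r * q + e < transmissionTime r m k := by
    have := mul_add_lt_mul_of_lt hq he
    rw [mul_comm q, mul_comm (streamLen m k)] at this
    rw [transmissionTime]
    omega
  simp only [if_pos in_time]
  rw [Protocol.received, sent_eq_nodeStream w z (by omega) hq he]

/-- The message `w` followed by zeros. -/
def zeroPad {k : ℕ} (w : Fin k → Bool) (x : ℕ) : Bool := if h : x < k then w ⟨x, h⟩ else false

theorem isEncodedBlock_sourceStream (m k : ℕ) (w : Fin k → Bool) (q : ℕ) :
    IsEncodedBlock (endLevel m k) (sourceStream m k w) q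
      fun s => zeroPad w (q * msgLen (endLevel m k) + s) := by
  intro s hs
  simp only [sourceStream, mul_add_div_of_lt q hs, Nat.mul_add_mod_of_lt hs]
  rfl

theorem div_msgLen_lt_numBlocks {m k x : ℕ} (hx : x < k) :
    x / msgLen (endLevel m k) < numBlocks m k := by
  have len_pos := msgLen_pos (endLevel m k)
  calc x / msgLen (endLevel m k) < (x + msgLen (endLevel m k)) / msgLen (endLevel m k) := by
        rw [Nat.add_div_right _ len_pos]
        exact Nat.lt_succ_self _
    _ ≤ numBlocks m k := Nat.div_le_div_right (by omega)

theorem estimate_eq_of_not_failsWithin {r m k : ℕ} (hm : 0 < m) (w : Fin k → Bool)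
    (z : ℕ → ℕ → Bool)
    (hF : ∀ q < numBlocks m k, ¬ FailsWithin (VoteFails r z) (endLevel m k)
      (tSeq (endLevel m k + 1)) 0 q) :
    (multiBit r m k).estimate m w z = w := by
  funext x
  set D := endLevel m k
  have block_lt : (x : ℕ) / msgLen D < numBlocks m k := div_msgLen_lt_numBlocks x.2
  have decoded := (isChain_nodeStream r m k w z).isDecodedBlock_last hm
    (fun j => level_le_endLevel k) (le_tProd_endLevel_succ m k)
    (isEncodedBlock_sourceStream m k w _) (hF _ block_lt)
  calc (multiBit r m k).estimate m w z x
      = levelDecode D (fun s => noisyVotes r z (m - 1) (nodeStream r m k w z (m - 1))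
          (x / msgLen D * codeLen D + s)) (x % msgLen D) :=
        levelDecode_congr (fun s hs => votes_received hm w z (mul_add_lt_mul_of_lt block_lt hs))
          (Nat.mod_lt _ (msgLen_pos D))
    _ = zeroPad w (x / msgLen D * msgLen D + x % msgLen D) :=
        decoded _ (Nat.mod_lt _ (msgLen_pos D))
    _ = w x := by rw [Nat.div_add_mod', zeroPad, dif_pos x.2]

/-! ## Probabilities of failure -/

theorem exists_preimage_of_dependsOn {ι β : Type*} {P : (ι → β) → Prop} {s : Set ι} [Fintype s]
    (hP : DependsOn P s) :
    ∃ A : Set (s.toFinset → β), {z | P z} = (fun z (i : s.toFinset) => z i) ⁻¹' A := by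
  refine ⟨(fun z (i : s.toFinset) => z i) '' {z | P z},
    (Set.subset_preimage_image _ _).antisymm ?_⟩
  rintro z ⟨z', hz', agree⟩
  exact (hP fun i hi => congrFun agree ⟨i, Set.mem_toFinset.2 hi⟩).mp hz'

theorem measureReal_and_of_disjoint_dependsOn {ι β : Type*} [Fintype ι] [MeasurableSpace β]
    [MeasurableSingletonClass β] [Finite β] (μ : ι → Measure β)
    [∀ i, IsProbabilityMeasure (μ i)] {P Q : (ι → β) → Prop} {s t : Set ι}
    (hP : DependsOn P s) (hQ : DependsOn Q t) (hst : Disjoint s t) :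
    (Measure.pi μ).real {z | P z ∧ Q z} =
      (Measure.pi μ).real {z | P z} * (Measure.pi μ).real {z | Q z} := by
  classical
  have indep := (iIndepFun_pi (X := fun _ => id) (μ := μ) fun i => aemeasurable_id).indepFun_finset
    s.toFinset t.toFinset (Set.disjoint_toFinset.2 hst) fun i => measurable_pi_apply i
  obtain ⟨A, hA⟩ := exists_preimage_of_dependsOn hP
  obtain ⟨B, hB⟩ := exists_preimage_of_dependsOn hQ
  have key := indep.measure_inter_preimage_eq_mul A B A.toFinite.measurableSet
    B.toFinite.measurableSet
  simp only [id_eq, ← hA, ← hB] at key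
  rw [Set.ofPred_and, measureReal_def, key, ENNReal.toReal_mul]
  rfl

section UnionBound

variable {Ω : Type*} [MeasurableSpace Ω] (μ : Measure Ω) (B : ℕ) {c : ℝ} {P : ℕ → Ω → Prop}

theorem measureReal_exists_lt_le (h : ∀ a < B, μ.real {z | P a z} ≤ c) :
    μ.real {z | ∃ a < B, P a z} ≤ B * c := by
  have eq_biUnion : {z | ∃ a < B, P a z} = ⋃ a ∈ Finset.range B, {z | P a z} := by ext z; simp
  rw [eq_biUnion]
  calc μ.real (⋃ a ∈ Finset.range B, {z | P a z})
      ≤ ∑ a ∈ Finset.range B, μ.real {z | P a z} := measureReal_biUnion_finset_le _ _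
    _ ≤ (Finset.range B).card • c :=
        Finset.sum_le_card_nsmul _ _ c fun a ha => h a (Finset.mem_range.1 ha)
    _ = B * c := by rw [Finset.card_range, nsmul_eq_mul]

open Classical in
theorem measureReal_one_lt_card_le [IsFiniteMeasure μ] (hc : 0 ≤ c)
    (h : ∀ a b, a ≠ b → μ.real {z | P a z ∧ P b z} ≤ c) :
    μ.real {z | 1 < ((Finset.range B).filter fun a => P a z).card} ≤ B ^ 2 * c := by
  have exists_pair : {z | 1 < ((Finset.range B).filter fun a => P a z).card} ⊆
      {z | ∃ a < B, ∃ b < B, a ≠ b ∧ P a z ∧ P b z} := by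
    intro z hz
    obtain ⟨a, ha, b, hb, hab⟩ := Finset.one_lt_card.1 hz
    simp only [Finset.mem_filter, Finset.mem_range] at ha hb
    exact ⟨a, ha.1, b, hb.1, hab, ha.2, hb.2⟩
  refine (measureReal_mono exists_pair).trans ?_
  rw [sq, mul_assoc]
  refine measureReal_exists_lt_le μ B fun a _ => measureReal_exists_lt_le μ B fun b _ => ?_
  by_cases hab : a = b
  · simpa [hab] using hc
  · simpa [hab] using h a b hab

end UnionBound

section Hoeffding

variable {ι : Type*} [Fintype ι] {p : unitInterval}

theorem hasSubgaussianMGF_ite_sub (x : ι) :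
    HasSubgaussianMGF (fun z : ι → Bool => (if z x = true then 1 else 0) - (p : ℝ))
      (1 / 4) (Measure.pi fun _ => bernoulliMeasure true false p) := by
  set f : Bool → ℝ := fun b => if b = true then 1 else 0 with hf
  have measurable_eval : Measurable fun z : ι → Bool => f (z x) :=
    (measurable_from_top (f := f)).comp (measurable_pi_apply x)
  have integral_eval :
      ∫ z : ι → Bool, f (z x) ∂(Measure.pi fun _ => bernoulliMeasure true false p) = p := by
    rw [integral_comp_eval (μ := fun _ : ι => bernoulliMeasure true false p) (f := f)
      measurable_from_top.aestronglyMeasurable, integral_bernoulliMeasure]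
    simp [hf]
  have key := hasSubgaussianMGF_of_mem_Icc (a := 0) (b := 1) measurable_eval.aemeasurable
    (ae_of_all (Measure.pi fun _ => bernoulliMeasure true false p) fun z => by
      simp only [hf]; split_ifs <;> simp)
  rw [integral_eval] at key
  convert key using 1
  ext
  norm_num

theorem measureReal_two_mul_card_ge_le (hp : (p : ℝ) ≤ 1 / 2) {r : ℕ} {A : Finset ι}
    (hA : A.card ≤ r) :
    (Measure.pi fun _ : ι => bernoulliMeasure true false p).real
      {z | r ≤ 2 * (A.filter fun x => z x = true).card} ≤
        Real.exp (-(2 * (1 / 2 - p) ^ 2)) ^ r := by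
  obtain rfl | hA' := A.eq_empty_or_nonempty
  · obtain rfl | hr := r.eq_zero_or_pos
    · simp
    · simp only [Finset.filter_empty, Finset.card_empty, mul_zero, hr.not_ge, Set.ofPred_false,
        measureReal_empty]
      positivity
  have indep : iIndepFun (fun x (z : ι → Bool) => (if z x = true then 1 else 0) - (p : ℝ))
      (Measure.pi fun _ : ι => bernoulliMeasure true false p) :=
    iIndepFun_pi (X := fun _ b => (if b = true then 1 else 0) - (p : ℝ)) fun _ =>
      measurable_from_top.aemeasurable
  have card_le : (A.card : ℝ) ≤ r := mod_cast hA
  have deviation_le : r * (1 / 2 - p : ℝ) ≤ r / 2 - A.card * p := by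
    have : (A.card * p : ℝ) ≤ r * p := by gcongr; exact p.2.1
    linarith
  have deviation_nonneg : 0 ≤ r * (1 / 2 - p : ℝ) := mul_nonneg r.cast_nonneg (by linarith)
  calc _ ≤ (Measure.pi fun _ : ι => bernoulliMeasure true false p).real
          {z | r * (1 / 2 - p : ℝ) ≤ ∑ x ∈ A, ((if z x = true then 1 else 0) - (p : ℝ))} := by
        refine measureReal_mono fun z hz => ?_
        have hz' : (r : ℝ) ≤ 2 * (A.filter fun x => z x = true).card := mod_cast hz
        simp only [Set.mem_ofPred_eq, Finset.sum_sub_distrib, Finset.sum_boole,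
          Finset.sum_const, nsmul_eq_mul]
        linarith
    _ ≤ Real.exp (-(r * (1 / 2 - p)) ^ 2 / (2 * (A.card / 4))) := by
        have := HasSubgaussianMGF.measure_sum_ge_le_of_iIndepFun indep
          (fun x _ => hasSubgaussianMGF_ite_sub x) (s := A) deviation_nonneg
        simpa [div_eq_mul_inv] using this
    _ ≤ Real.exp (-(2 * (1 / 2 - p) ^ 2)) ^ r := by
        rw [← Real.exp_nat_mul, Real.exp_le_exp]
        have : (0 : ℝ) < A.card := mod_cast hA'.card_pos
        have : r * (1 / 2 - p : ℝ) ^ 2 * A.card ≤ r * (1 / 2 - p : ℝ) ^ 2 * r := by gcongr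
        rw [neg_div, mul_neg, neg_le_neg_iff, le_div_iff₀ (by positivity)]
        linarith

end Hoeffding

instance (p : unitInterval) (m n : ℕ) : IsProbabilityMeasure (noiseLaw p m n) := by
  unfold noiseLaw
  infer_instance

theorem measureReal_voteFails_le {p : unitInterval} (hp : (p : ℝ) ≤ 1 / 2) (r m n j q : ℕ) :
    (noiseLaw p m n).real {z | VoteFails r (extendNoise z) j q} ≤
      Real.exp (-(2 * (1 / 2 - p) ^ 2)) ^ r := by
  set t := startTime r j + r * q
  set A : Finset (Fin m × Fin n) := Finset.univ.filter fun x =>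
    (x.1 : ℕ) = j ∧ t ≤ x.2 ∧ (x.2 : ℕ) < t + r with hA
  have card_le : A.card ≤ r := by
    rw [← Finset.card_range r]
    refine Finset.card_le_card_of_injOn (fun x => (x.2 : ℕ) - t) (fun x hx => ?_)
      fun x hx y hy hxy => ?_
    · simp only [hA, Finset.coe_filter, Finset.mem_univ, true_and, Set.mem_ofPred_eq,
        Finset.coe_range, Set.mem_Iio] at hx ⊢
      omega
    · simp only [hA, Finset.coe_filter, Finset.mem_univ, true_and, Set.mem_ofPred_eq] at hx hy hxy
      exact Prod.ext (Fin.ext (by omega)) (Fin.ext (by omega))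
  refine (measureReal_mono fun z hz => hz.trans (Nat.mul_le_mul_left 2 ?_)).trans
    (measureReal_two_mul_card_ge_le hp card_le)
  refine (Finset.card_le_card fun e he => ?_).trans
    (Finset.card_image_le (f := fun x : Fin m × Fin n => (x.2 : ℕ) - t))
  rw [Finset.mem_filter, Finset.mem_range, extendNoise] at he
  split_ifs at he with in_range
  · refine Finset.mem_image.2 ⟨(⟨j, in_range.1⟩, ⟨_, in_range.2⟩), ?_, Nat.add_sub_cancel_left _ _⟩
    simp only [hA, Finset.mem_filter, Finset.mem_univ, true_and, he.2, and_true]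
    omega
  · exact he.2.elim

/-- The channel uses on which the failure of the `q`-th block of level `l` depends, on any
hop. -/
def blockUses (r m n l q : ℕ) : Set (Fin m × Fin n) :=
  {x | startTime r x.1 + r * (q * codeLen l) ≤ x.2 ∧
    (x.2 : ℕ) < startTime r x.1 + r * ((q + 1) * codeLen l)}

theorem blockUses_succ_subset {r m n l q a : ℕ} (ha : a < numSub (l + 1)) :
    blockUses r m n l (q * numSub (l + 1) + a) ⊆ blockUses r m n (l + 1) q := by
  rintro x ⟨start_le, lt_end⟩
  have first_le : q * codeLen (l + 1) ≤ (q * numSub (l + 1) + a) * codeLen l := by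
    rw [codeLen_succ, ← mul_assoc]
    exact Nat.mul_le_mul_right _ (Nat.le_add_right _ _)
  have last_le : (q * numSub (l + 1) + a + 1) * codeLen l ≤ (q + 1) * codeLen (l + 1) := by
    have : q * numSub (l + 1) + a + 1 ≤ (q + 1) * numSub (l + 1) := by rw [add_one_mul]; omega
    rw [codeLen_succ, ← mul_assoc]
    exact Nat.mul_le_mul_right _ this
  exact ⟨start_le.trans' (Nat.add_le_add_left (Nat.mul_le_mul_left r first_le) _),
    lt_end.trans_le (Nat.add_le_add_left (Nat.mul_le_mul_left r last_le) _)⟩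

theorem disjoint_blockUses {r m n l q q' : ℕ} (h : q ≠ q') :
    Disjoint (blockUses r m n l q) (blockUses r m n l q') := by
  wlog hlt : q < q' generalizing q q'
  · exact (this h.symm (by omega)).symm
  rw [Set.disjoint_left]
  rintro x ⟨-, lt_end⟩ ⟨start_le, -⟩
  have : r * ((q + 1) * codeLen l) ≤ r * (q' * codeLen l) := by gcongr; omega
  omega

theorem dependsOn_voteFails (r m n j q : ℕ) :
    DependsOn (fun z : Fin m × Fin n → Bool => VoteFails r (extendNoise z) j q)
      (blockUses r m n 0 q) := by
  intro z z' agree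
  unfold VoteFails
  refine congrArg (fun s : Finset ℕ => r ≤ 2 * s.card) (Finset.filter_congr fun e he => ?_)
  rw [Finset.mem_range] at he
  unfold extendNoise
  split_ifs with in_range
  · have codeLen_zero : codeLen 0 = 1 := rfl
    rw [agree]
    simp only [blockUses, codeLen_zero, mul_one, mul_add, Set.mem_ofPred_eq]
    omega
  · rfl

theorem dependsOn_fails (r m n l j q : ℕ) :
    DependsOn (fun z : Fin m × Fin n → Bool => Fails (VoteFails r (extendNoise z)) l j q)
      (blockUses r m n l q) := by
  induction l generalizing j q with
  | zero => exact dependsOn_voteFails r m n j q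
  | succ l ih =>
    intro z z' agree
    classical
    simp only [fails_succ_iff]
    refine congrArg (fun s : Finset ℕ => errorThreshold (bSeq (l + 1)) ≤ s.card)
      (Finset.filter_congr fun a ha => ?_)
    exact exists_congr fun i => and_congr_right fun _ => Iff.of_eq <| ih _ _ fun x hx =>
      agree x (blockUses_succ_subset (Finset.mem_range.1 ha) hx)

theorem dependsOn_failsWithin (r m n l t j q : ℕ) :
    DependsOn (fun z : Fin m × Fin n → Bool => FailsWithin (VoteFails r (extendNoise z)) l t j q)
      (blockUses r m n l q) := fun _ _ agree =>
  propext <| exists_congr fun _ => and_congr_right fun _ =>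
    Iff.of_eq (dependsOn_fails r m n l _ _ agree)

section Bounds

variable {p : unitInterval} {r m n l : ℕ} {δ : ℝ}

theorem measureReal_failsWithin_le
    (h : ∀ j q, (noiseLaw p m n).real {z | Fails (VoteFails r (extendNoise z)) l j q} ≤ δ)
    (t j q : ℕ) :
    (noiseLaw p m n).real {z | FailsWithin (VoteFails r (extendNoise z)) l t j q} ≤ t * δ :=
  measureReal_exists_lt_le _ t fun _ _ => h _ _

theorem measureReal_fails_succ_le
    (h : ∀ j q, (noiseLaw p m n).real {z | Fails (VoteFails r (extendNoise z)) l j q} ≤ δ)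
    (j q : ℕ) :
    (noiseLaw p m n).real {z | Fails (VoteFails r (extendNoise z)) (l + 1) j q} ≤
      numSub (l + 1) * (tSeq (l + 1) * δ) := by
  classical
  have threshold_pos : 0 < errorThreshold (bSeq (l + 1)) := by
    unfold errorThreshold
    split_ifs <;> norm_num
  refine (measureReal_mono fun z hz => ?_).trans (measureReal_exists_lt_le _ (numSub (l + 1))
    fun a _ => measureReal_failsWithin_le h (tSeq (l + 1)) j (q * numSub (l + 1) + a))
  obtain ⟨a, ha⟩ := Finset.card_pos.1 (threshold_pos.trans_le (fails_succ_iff.1 hz))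
  rw [Finset.mem_filter, Finset.mem_range] at ha
  exact ⟨a, ha⟩

theorem measureReal_fails_succ_le_sq (hl : 1 ≤ l)
    (h : ∀ j q, (noiseLaw p m n).real {z | Fails (VoteFails r (extendNoise z)) l j q} ≤ δ)
    (j q : ℕ) :
    (noiseLaw p m n).real {z | Fails (VoteFails r (extendNoise z)) (l + 1) j q} ≤
      numSub (l + 1) ^ 2 * (tSeq (l + 1) * δ) ^ 2 := by
  have threshold_eq : errorThreshold (bSeq (l + 1)) = 2 := by
    have := four_le_bSeq (show 2 ≤ l + 1 by omega)
    rw [errorThreshold, if_neg (by omega)]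
  have hδ := measureReal_failsWithin_le h (tSeq (l + 1)) j
  simp only [fails_succ_iff, threshold_eq]
  refine measureReal_one_lt_card_le _ (numSub (l + 1)) (sq_nonneg _) fun a a' hne => ?_
  rw [noiseLaw, measureReal_and_of_disjoint_dependsOn _ (dependsOn_failsWithin ..)
    (dependsOn_failsWithin ..) (disjoint_blockUses (by omega)), sq]
  exact mul_le_mul (hδ _) (hδ _) measureReal_nonneg (measureReal_nonneg.trans (hδ 0))

end Bounds

/-! ## The decay of the failure probability -/

/-- The bound `δ_l` on the probability that a level-`l` block fails, `l ≥ 1`.  It is a solution of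
`(l + 3)^8 δ_l² ≤ δ_{l+1}`, because `(l + 4)^8 ≤ 256 (l + 3)^8`. -/
noncomputable def failBound (l : ℕ) : ℝ := Real.exp (-2 ^ l) / (256 * (l + 3) ^ 8)

theorem cast_tSeq_succ (l : ℕ) : (tSeq (l + 1) : ℝ) = (l + 3) ^ 2 := by
  rw [tSeq]
  push_cast
  ring

theorem numSub_mul_tSeq_le (l : ℕ) : (numSub (l + 1) * tSeq (l + 1) : ℝ) ≤ (l + 3) ^ 4 := by
  have numSub_le : (numSub (l + 1) : ℝ) ≤ tSeq (l + 1) :=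
    mod_cast (Nat.le_mul_of_pos_left _ two_pos).trans (two_mul_numSub_le l)
  calc (numSub (l + 1) * tSeq (l + 1) : ℝ) ≤ tSeq (l + 1) * tSeq (l + 1) := by gcongr
    _ = (l + 3) ^ 4 := by rw [cast_tSeq_succ]; ring

theorem pow_mul_failBound_sq_le (l : ℕ) :
    ((l + 3 : ℝ) ^ 4) ^ 2 * failBound l ^ 2 ≤ failBound (l + 1) := by
  have pow_le : (((l + 1 : ℕ) : ℝ) + 3) ^ 8 ≤ 256 * ((l : ℝ) + 3) ^ 8 := by
    calc (((l + 1 : ℕ) : ℝ) + 3) ^ 8 ≤ (2 * ((l : ℝ) + 3)) ^ 8 := by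
          gcongr
          push_cast
          linarith [(Nat.cast_nonneg l : (0 : ℝ) ≤ l)]
      _ = 256 * ((l : ℝ) + 3) ^ 8 := by ring
  have exp_eq : Real.exp (-2 ^ (l + 1)) = Real.exp (-2 ^ l) ^ 2 := by
    rw [← Real.exp_nat_mul]
    congr 1
    push_cast
    ring
  calc ((l + 3 : ℝ) ^ 4) ^ 2 * failBound l ^ 2
      = Real.exp (-2 ^ l) ^ 2 / (256 * (256 * (l + 3) ^ 8)) := by unfold failBound; field_simp
    _ ≤ failBound (l + 1) := by rw [failBound, exp_eq]; gcongr

theorem measureReal_fails_le {p : unitInterval} {r m n : ℕ}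
    (h : ∀ j q, (noiseLaw p m n).real {z | VoteFails r (extendNoise z) j q} ≤ failBound 1 / 81)
    {l : ℕ} (hl : 1 ≤ l) (j q : ℕ) :
    (noiseLaw p m n).real {z | Fails (VoteFails r (extendNoise z)) l j q} ≤ failBound l := by
  induction l, hl using Nat.le_induction generalizing j q with
  | base =>
    have bound_nonneg : 0 ≤ failBound 1 / 81 := measureReal_nonneg.trans (h 0 0)
    calc _ ≤ numSub 1 * (tSeq 1 * (failBound 1 / 81)) := measureReal_fails_succ_le (l := 0) h j q
      _ = (numSub 1 * tSeq 1) * (failBound 1 / 81) := (mul_assoc _ _ _).symm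
      _ ≤ 81 * (failBound 1 / 81) := by
        gcongr
        exact (numSub_mul_tSeq_le 0).trans_eq (by norm_num)
      _ = failBound 1 := mul_div_cancel₀ _ (by norm_num)
  | succ l hl ih =>
    calc _ ≤ numSub (l + 1) ^ 2 * (tSeq (l + 1) * failBound l) ^ 2 :=
          measureReal_fails_succ_le_sq hl ih j q
      _ = (numSub (l + 1) * tSeq (l + 1)) ^ 2 * failBound l ^ 2 := by ring
      _ ≤ ((l + 3 : ℝ) ^ 4) ^ 2 * failBound l ^ 2 := by
        gcongr
        exact numSub_mul_tSeq_le l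
      _ ≤ failBound (l + 1) := pow_mul_failBound_sq_le l

theorem errorProb_multiBit_le {p : unitInterval} {r m k : ℕ} (hm : 0 < m)
    (h : ∀ j q, (noiseLaw p m (transmissionTime r m k)).real
      {z | VoteFails r (extendNoise z) j q} ≤ failBound 1 / 81)
    (hD : 1 ≤ endLevel m k) (w : Fin k → Bool) :
    (multiBit r m k).errorProb p m w ≤
      numBlocks m k * (tSeq (endLevel m k + 1) * failBound (endLevel m k)) := by
  refine (measureReal_mono fun z hz => ?_).trans (measureReal_exists_lt_le _ (numBlocks m k)
    fun q _ => measureReal_failsWithin_le (measureReal_fails_le h hD)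
      (tSeq (endLevel m k + 1)) 0 q)
  by_contra! no_failure
  exact hz (estimate_eq_of_not_failsWithin hm w _ fun q hq hF => no_failure ⟨q, hq, hF⟩)

theorem exists_repetitions {p : unitInterval} (hp : (p : ℝ) < 1 / 2) :
    ∃ r : ℕ, 0 < r ∧ ∀ m n j q,
      (noiseLaw p m n).real {z | VoteFails r (extendNoise z) j q} ≤ failBound 1 / 81 := by
  have bound_pos : 0 < failBound 1 / 81 := by unfold failBound; positivity
  have base_lt_one : Real.exp (-(2 * (1 / 2 - p) ^ 2)) < 1 := by
    have := sub_pos.2 hp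
    rw [Real.exp_lt_one_iff, neg_lt_zero]
    positivity
  obtain ⟨r, hr⟩ := exists_pow_lt_of_lt_one bound_pos base_lt_one
  refine ⟨r + 1, r.succ_pos, fun m n j q => ?_⟩
  calc _ ≤ Real.exp (-(2 * (1 / 2 - p) ^ 2)) ^ (r + 1) := measureReal_voteFails_le hp.le ..
    _ ≤ Real.exp (-(2 * (1 / 2 - p) ^ 2)) ^ r :=
      pow_le_pow_of_le_one (Real.exp_pos _).le base_lt_one.le r.le_succ
    _ ≤ failBound 1 / 81 := hr.le

/-! ## Transmission time -/

theorem sum_codeLen_level_le (m : ℕ) : ∑ j ∈ Finset.Icc 1 m, codeLen (level j) ≤ 2 * m := by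
  have codeLen_level_le (j : ℕ) (hj : j ∈ Finset.Icc 1 m) : codeLen (level j) ≤
      ∑ l ∈ Finset.range (m + 1), if tProd l ∣ j then codeLen l else 0 := by
    have level_le : level j ≤ m := (Nat.findGreatest_le _).trans (Finset.mem_Icc.1 hj).2
    calc codeLen (level j) = if tProd (level j) ∣ j then codeLen (level j) else 0 :=
          (if_pos (tProd_level_dvd j)).symm
      _ ≤ _ := Finset.single_le_sum (f := fun l => if tProd l ∣ j then codeLen l else 0)
        (fun _ _ => Nat.zero_le _) (Finset.mem_range.2 (Nat.lt_succ_of_le level_le))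
  have sum_multiples (l : ℕ) :
      (∑ j ∈ Finset.Icc 1 m, if tProd l ∣ j then codeLen l else 0) = m / tProd l * codeLen l := by
    have card_multiples : ((Finset.Icc 1 m).filter fun j => tProd l ∣ j).card = m / tProd l :=
      Nat.Ioc_filter_dvd_card_eq_div m (tProd l)
    rw [← Finset.sum_filter, Finset.sum_const, card_multiples, smul_eq_mul]
  have geometric (l : ℕ) : m / tProd l * codeLen l ≤ m / 2 ^ l := by
    rw [Nat.le_div_iff_mul_le (by positivity), mul_assoc]
    exact (Nat.mul_le_mul_left _ (codeLen_mul_two_pow_le l)).trans (Nat.div_mul_le_self _ _)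
  calc ∑ j ∈ Finset.Icc 1 m, codeLen (level j)
      ≤ ∑ j ∈ Finset.Icc 1 m, ∑ l ∈ Finset.range (m + 1), if tProd l ∣ j then codeLen l else 0 :=
        Finset.sum_le_sum codeLen_level_le
    _ = ∑ l ∈ Finset.range (m + 1), m / tProd l * codeLen l := by
        rw [Finset.sum_comm, Finset.sum_congr rfl fun l _ => sum_multiples l]
    _ ≤ ∑ l ∈ Finset.range (m + 1), m / 2 ^ l := Finset.sum_le_sum fun l _ => geometric l
    _ ≤ m * 2 / (2 - 1) := Nat.geom_sum_le le_rfl m _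
    _ = 2 * m := by rw [Nat.div_one, mul_comm]

theorem startTime_le (r m : ℕ) : startTime r m ≤ r * (2 * m) := by
  rw [startTime, ← Finset.mul_sum]
  exact Nat.mul_le_mul_left r (sum_codeLen_level_le m)

theorem le_startTime {r : ℕ} (hr : 0 < r) (m : ℕ) : m ≤ startTime r m := by
  calc m = ∑ j ∈ Finset.Icc 1 m, 1 := by simp
    _ ≤ startTime r m := Finset.sum_le_sum fun j _ => Nat.mul_pos hr (codeLen_pos _)

theorem le_transmissionTime_add_one {r : ℕ} (hr : 0 < r) (m k : ℕ) :
    m ≤ transmissionTime r m k + 1 := by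
  have := le_startTime hr (m - 1)
  unfold transmissionTime
  omega

-- Any exponent below `1 / 2` makes the rate loss `redundancy (bSeq l) / bSeq l` summable.
theorem redundancy_le_rpow {b : ℕ} (hb : 1 ≤ b) :
    (redundancy b : ℝ) ≤ 10 * (b : ℝ) ^ (1 / 4 : ℝ) := by
  have hb' : (1 : ℝ) ≤ b := mod_cast hb
  have one_le : 1 ≤ (b : ℝ) ^ (1 / 4 : ℝ) := Real.one_le_rpow hb' (by norm_num)
  have log_le : Real.log b ≤ 4 * (b : ℝ) ^ (1 / 4 : ℝ) := by
    have := Real.log_le_rpow_div (zero_le_one.trans hb') (show (0 : ℝ) < 1 / 4 by norm_num)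
    linarith
  have logb_le : Real.logb 2 b ≤ 8 * (b : ℝ) ^ (1 / 4 : ℝ) := by
    have := Real.log_two_gt_d9
    rw [Real.logb, div_le_iff₀ (by linarith)]
    nlinarith
  have clog_eq : ⌈Real.logb 2 b⌉₊ = Nat.clog 2 b := mod_cast Real.natCeil_logb_natCast 2 b
  have ceil_le := (Nat.ceil_lt_add_one (Real.logb_nonneg one_lt_two hb')).le
  rw [clog_eq] at ceil_le
  rw [redundancy]
  push_cast
  linarith

theorem sq_div_two_le_bSeq (l : ℕ) : (((l : ℝ) + 1) / 2) ^ 2 ≤ bSeq l := by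
  have sq_le : (l + 1) ^ 2 ≤ 4 * bSeq l := by
    have div_add_mod : 4 * bSeq l + _ = _ := Nat.div_add_mod ((l + 2) ^ 2) 4
    have := Nat.mod_lt ((l + 2) ^ 2) four_pos
    have sq_eq : (l + 2) ^ 2 = (l + 1) ^ 2 + 2 * l + 3 := by ring
    omega
  have sq_le' : ((l : ℝ) + 1) ^ 2 ≤ 4 * bSeq l := mod_cast sq_le
  linarith

theorem bSeq_pos (l : ℕ) : 0 < bSeq l := by
  have : (0 : ℝ) < bSeq l := (sq_div_two_le_bSeq l).trans_lt' (by positivity)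
  exact_mod_cast this

theorem summable_redundancy_div_bSeq :
    Summable fun l => (redundancy (bSeq l) / bSeq l : ℝ) := by
  have majorant : Summable fun l : ℕ => 10 * (1 / 2 : ℝ) ^ (-3 / 2 : ℝ) *
      (((l + 1 : ℕ) : ℝ) ^ (-3 / 2 : ℝ)) :=
    ((summable_nat_add_iff 1).2 (Real.summable_nat_rpow.2 (by norm_num))).mul_left _
  refine majorant.of_nonneg_of_le (fun l => by positivity) fun l => ?_
  have bSeq_pos' : (0 : ℝ) < bSeq l := mod_cast bSeq_pos l
  calc (redundancy (bSeq l) / bSeq l : ℝ)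
      ≤ 10 * (bSeq l : ℝ) ^ (1 / 4 : ℝ) / bSeq l := by
        gcongr
        exact redundancy_le_rpow (bSeq_pos l)
    _ = 10 * (bSeq l : ℝ) ^ (-3 / 4 : ℝ) := by
        rw [mul_div_assoc, ← Real.rpow_sub_one bSeq_pos'.ne']
        norm_num
    _ ≤ 10 * ((((l : ℝ) + 1) / 2) ^ 2) ^ (-3 / 4 : ℝ) := by
        gcongr ?_ * ?_
        exact Real.rpow_le_rpow_of_nonpos (by positivity) (sq_div_two_le_bSeq l) (by norm_num)
    _ = 10 * (1 / 2 : ℝ) ^ (-3 / 2 : ℝ) * ((l + 1 : ℕ) : ℝ) ^ (-3 / 2 : ℝ) := by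
        rw [← Real.rpow_natCast, ← Real.rpow_mul (by positivity), mul_assoc,
          ← Real.mul_rpow (by norm_num) (by positivity)]
        push_cast
        ring_nf

theorem exists_codeLen_le_mul_msgLen : ∃ R : ℝ, 0 < R ∧ ∀ l, (codeLen l : ℝ) ≤ R * msgLen l := by
  refine ⟨Real.exp (∑' l, (redundancy (bSeq l) / bSeq l : ℝ)), Real.exp_pos _, fun l => ?_⟩
  have factor (i : ℕ) : (bSeq i + redundancy (bSeq i) : ℝ) =
      (1 + redundancy (bSeq i) / bSeq i) * bSeq i := by
    have : (bSeq i : ℝ) ≠ 0 := mod_cast (bSeq_pos i).ne'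
    field_simp
  calc (codeLen l : ℝ)
      = (∏ i ∈ Finset.Icc 1 l, (1 + redundancy (bSeq i) / bSeq i : ℝ)) * msgLen l := by
        rw [codeLen, msgLen]
        push_cast
        simp only [factor, Finset.prod_mul_distrib]
    _ ≤ Real.exp (∑ i ∈ Finset.Icc 1 l, (redundancy (bSeq i) / bSeq i : ℝ)) * msgLen l := by
        gcongr
        exact Real.prod_one_add_le_exp_sum _ fun i => by positivity
    _ ≤ _ := by
        gcongr
        exact summable_redundancy_div_bSeq.sum_le_tsum _ fun i _ => by positivity

theorem tProd_maxRelayLevel_le {m : ℕ} (hm : 0 < m) : tProd (maxRelayLevel m) ≤ m :=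
  Finset.sup_induction (p := fun l => tProd l ≤ m) hm
    (fun a ha b hb => by rcases max_choice a b with h | h <;> simpa only [h]) fun j hj => by
    rw [Finset.mem_Icc] at hj
    exact (Nat.le_of_dvd hj.1 (tProd_level_dvd j)).trans (by omega)

theorem lt_msgLen_msgLevel_succ (k : ℕ) : k < msgLen (msgLevel k + 1) := by
  by_contra! h
  exact absurd (Nat.le_findGreatest (P := fun l => msgLen l ≤ k)
    ((Nat.lt_two_pow_self.le.trans (two_pow_le_msgLen _)).trans h) h) (Nat.lt_succ_self _).not_ge

theorem msgLen_msgLevel_le (k : ℕ) : msgLen (msgLevel k) ≤ k + 1 := by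
  obtain rfl | hk := k.eq_zero_or_pos
  · exact le_rfl
  · exact (Nat.findGreatest_spec (P := fun l => msgLen l ≤ k) k.zero_le hk).trans k.le_succ

theorem lt_msgLen_of_msgLevel_lt {k l : ℕ} (h : msgLevel k < l) : k < msgLen l :=
  (lt_msgLen_msgLevel_succ k).trans_le (Nat.le_of_dvd (msgLen_pos l) (msgLen_dvd h))

theorem numBlocks_le_bSeq (m k : ℕ) : numBlocks m k ≤ bSeq (endLevel m k + 1) := by
  have lt_len : k < msgLen (endLevel m k + 1) :=
    lt_msgLen_of_msgLevel_lt (Nat.lt_succ_of_le (le_max_left _ _))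
  have len_pos := msgLen_pos (endLevel m k)
  rw [msgLen_succ] at lt_len
  rw [numBlocks, ← Nat.lt_succ_iff, Nat.div_lt_iff_lt_mul len_pos, Nat.succ_mul]
  omega

theorem streamLen_le_of_maxRelayLevel_le {R : ℝ} (hR : 0 < R)
    (hRl : ∀ l, (codeLen l : ℝ) ≤ R * msgLen l) {m k : ℕ} (h : maxRelayLevel m ≤ msgLevel k) :
    (streamLen m k : ℝ) ≤ 2 * R * k := by
  have endLevel_eq : endLevel m k = msgLevel k := max_eq_left h
  have padded_le : numBlocks m k * msgLen (msgLevel k) ≤ 2 * k := by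
    rw [numBlocks, endLevel_eq]
    have := msgLen_msgLevel_le k
    exact (Nat.div_mul_le_self _ _).trans (by omega)
  have padded_le' : (numBlocks m k * msgLen (msgLevel k) : ℝ) ≤ 2 * k := mod_cast padded_le
  rw [streamLen, endLevel_eq]
  push_cast
  calc (numBlocks m k * codeLen (msgLevel k) : ℝ)
      ≤ numBlocks m k * (R * msgLen (msgLevel k)) := by gcongr; exact hRl _
    _ = R * (numBlocks m k * msgLen (msgLevel k)) := by ring
    _ ≤ R * (2 * k) := by gcongr
    _ = 2 * R * k := by ring

theorem streamLen_le_of_msgLevel_lt {m k : ℕ} (hm : 0 < m) (h : msgLevel k < maxRelayLevel m) :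
    streamLen m k ≤ m := by
  have endLevel_eq : endLevel m k = maxRelayLevel m := max_eq_right h.le
  have numBlocks_le : numBlocks m k ≤ 1 := by
    have := lt_msgLen_of_msgLevel_lt h
    rw [numBlocks, endLevel_eq, ← Nat.lt_succ_iff, Nat.div_lt_iff_lt_mul (msgLen_pos _)]
    omega
  calc streamLen m k ≤ 1 * codeLen (maxRelayLevel m) := by
        rw [streamLen, endLevel_eq]
        exact Nat.mul_le_mul_right _ numBlocks_le
    _ ≤ tProd (maxRelayLevel m) := by
        rw [one_mul]
        exact (Nat.le_mul_of_pos_right _ (by positivity)).trans (codeLen_mul_two_pow_le _)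
    _ ≤ m := tProd_maxRelayLevel_le hm

theorem exists_transmissionTime_le (r : ℕ) :
    ∃ C : ℝ, 0 < C ∧ ∀ m k, 0 < m → (transmissionTime r m k : ℝ) ≤ C * (m + k) := by
  obtain ⟨R, hR, hRl⟩ := exists_codeLen_le_mul_msgLen
  refine ⟨r * (3 + 2 * R) + 1, by positivity, fun m k hm => ?_⟩
  have streamLen_le : (streamLen m k : ℝ) ≤ 2 * R * k + m := by
    rcases le_or_gt (maxRelayLevel m) (msgLevel k) with h | h
    · linarith [streamLen_le_of_maxRelayLevel_le hR hRl h, (m.cast_nonneg : (0 : ℝ) ≤ m)]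
    · have : (streamLen m k : ℝ) ≤ m := mod_cast streamLen_le_of_msgLevel_lt hm h
      linarith [show 0 ≤ 2 * R * k by positivity]
  have start_le : (startTime r (m - 1) : ℝ) ≤ r * (2 * m) :=
    mod_cast (startTime_le r (m - 1)).trans (by gcongr; omega)
  calc (transmissionTime r m k : ℝ) = startTime r (m - 1) + r * streamLen m k := by
        rw [transmissionTime]
        push_cast
        rfl
    _ ≤ r * (2 * m) + r * (2 * R * k + m) := by gcongr
    _ ≤ (r * (3 + 2 * R) + 1) * (m + k) := by
        have : 0 ≤ r * (2 * R * m + 3 * k) + (m + k : ℝ) := by positivity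
        linarith

/-! ## The exponent -/

theorem tProd_le_pow (l : ℕ) : tProd l ≤ (l + 2) ^ (2 * l) := by
  calc tProd l ≤ ∏ _i ∈ Finset.Icc 1 l, (l + 2) ^ 2 := Finset.prod_le_prod' fun i hi =>
        Nat.pow_le_pow_left (Nat.add_le_add_right (Finset.mem_Icc.1 hi).2 2) 2
    _ = (l + 2) ^ (2 * l) := by simp [pow_mul]

theorem one_le_endLevel {m : ℕ} (hm : 10 ≤ m) (k : ℕ) : 1 ≤ endLevel m k := by
  by_contra! h
  have := le_tProd_endLevel_succ m k
  simp only [Nat.lt_one_iff.1 h, tProd, tSeq, zero_add, Finset.Icc_self,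
    Finset.prod_singleton] at this
  omega

theorem streamLen_le_tProd (m k : ℕ) : streamLen m k ≤ tProd (endLevel m k + 1) := by
  calc streamLen m k
      ≤ (bSeq (endLevel m k + 1) + redundancy (bSeq (endLevel m k + 1))) *
          codeLen (endLevel m k) :=
        Nat.mul_le_mul_right _ ((numBlocks_le_bSeq m k).trans (Nat.le_add_right _ _))
    _ = codeLen (endLevel m k + 1) := (codeLen_succ _).symm
    _ ≤ codeLen (endLevel m k + 1) * 2 ^ (endLevel m k + 1) :=
        Nat.le_mul_of_pos_right _ (by positivity)
    _ ≤ tProd (endLevel m k + 1) := codeLen_mul_two_pow_le _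

theorem transmissionTime_le_pow {r m : ℕ} (hm : 3 * r ≤ m) (k : ℕ) :
    transmissionTime r m k ≤ (endLevel m k + 3) ^ (4 * (endLevel m k + 3)) := by
  set D := endLevel m k
  have m_le : m ≤ tProd (D + 1) := le_tProd_endLevel_succ m k
  calc transmissionTime r m k ≤ r * (2 * tProd (D + 1)) + r * tProd (D + 1) := by
        refine Nat.add_le_add ((startTime_le r (m - 1)).trans ?_)
          (Nat.mul_le_mul_left r (streamLen_le_tProd m k))
        gcongr
        omega
    _ = 3 * r * tProd (D + 1) := by ring
    _ ≤ tProd (D + 1) * tProd (D + 1) := Nat.mul_le_mul_right _ (hm.trans m_le)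
    _ ≤ (D + 3) ^ (2 * (D + 1)) * (D + 3) ^ (2 * (D + 1)) := by
        gcongr <;> exact tProd_le_pow (D + 1)
    _ ≤ (D + 3) ^ (4 * (D + 3)) := by
        rw [← pow_add]
        exact Nat.pow_le_pow_right (by omega) (by omega)

theorem log_div_log_log_le {x y a : ℝ} (ha : 1 ≤ a) (hy : 1 < y)
    (hx : Real.exp (Real.exp 1) ≤ x) (h : Real.log x ≤ a * y * Real.log y) :
    Real.log x / Real.log (Real.log x) ≤ a * y := by
  have exp_le_log : Real.exp 1 ≤ Real.log x :=
    (Real.le_log_iff_exp_le ((Real.exp_pos _).trans_le hx)).2 hx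
  have log_pos : 0 < Real.log x := (Real.exp_pos _).trans_le exp_le_log
  have one_le_loglog : 1 ≤ Real.log (Real.log x) := (Real.le_log_iff_exp_le log_pos).2 exp_le_log
  rw [div_le_iff₀ (by linarith)]
  rcases le_or_gt y (Real.log x) with y_le | lt_y
  · calc Real.log x ≤ a * y * Real.log y := h
      _ ≤ a * y * Real.log (Real.log x) := by gcongr
  · calc Real.log x ≤ 1 * y * 1 := by linarith
      _ ≤ a * y * Real.log (Real.log x) := by gcongr

theorem rpow_le_two_pow {x : ℝ} {D : ℕ} (hD : 1 ≤ D) (hx : Real.exp (Real.exp 1) ≤ x)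
    (h : x ≤ ((D : ℝ) + 3) ^ (4 * (D + 3))) :
    x ^ ((1 / 32 : ℝ) / Real.log (Real.log x)) ≤ 2 ^ D := by
  have x_pos : 0 < x := (Real.exp_pos _).trans_le hx
  have one_le_D : (1 : ℝ) ≤ D := mod_cast hD
  have log_le : Real.log x ≤ 4 * ((D : ℝ) + 3) * Real.log ((D : ℝ) + 3) := by
    have := Real.log_le_log x_pos h
    rw [Real.log_pow] at this
    exact_mod_cast this
  have quotient_le := log_div_log_log_le (by norm_num) (by linarith) hx log_le
  have two_pow_eq : (2 : ℝ) ^ D = Real.exp (D * Real.log 2) := by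
    rw [← Real.log_pow, Real.exp_log (by positivity)]
  rw [Real.rpow_def_of_pos x_pos, two_pow_eq, Real.exp_le_exp]
  calc Real.log x * (1 / 32 / Real.log (Real.log x))
      = 1 / 32 * (Real.log x / Real.log (Real.log x)) := by ring
    _ ≤ 1 / 32 * (4 * ((D : ℝ) + 3)) := by gcongr
    _ ≤ D * Real.log 2 := by nlinarith [Real.log_two_gt_d9]

theorem numBlocks_mul_failBound_le (m k : ℕ) :
    (numBlocks m k * (tSeq (endLevel m k + 1) * failBound (endLevel m k)) : ℝ) ≤
      Real.exp (-2 ^ endLevel m k) := by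
  set D := endLevel m k
  have numBlocks_le : (numBlocks m k : ℝ) ≤ ((D : ℝ) + 3) ^ 2 := by
    have : numBlocks m k ≤ (D + 3) ^ 2 := (numBlocks_le_bSeq m k).trans (Nat.div_le_self _ _)
    exact_mod_cast this
  have pow_le : ((D : ℝ) + 3) ^ 4 ≤ 256 * ((D : ℝ) + 3) ^ 8 := by
    have : ((D : ℝ) + 3) ^ 4 ≤ ((D : ℝ) + 3) ^ 8 :=
      pow_le_pow_right₀ (by linarith [(D.cast_nonneg : (0 : ℝ) ≤ D)]) (by norm_num)
    linarith [show 0 ≤ ((D : ℝ) + 3) ^ 8 by positivity]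
  rw [cast_tSeq_succ, failBound]
  calc (numBlocks m k * (((D : ℝ) + 3) ^ 2 * (Real.exp (-2 ^ D) / (256 * (D + 3) ^ 8))) : ℝ)
      ≤ ((D : ℝ) + 3) ^ 2 * (((D : ℝ) + 3) ^ 2 *
          (Real.exp (-2 ^ D) / (256 * (D + 3) ^ 8))) := by gcongr
    _ = ((D : ℝ) + 3) ^ 4 / (256 * (D + 3) ^ 8) * Real.exp (-2 ^ D) := by ring
    _ ≤ Real.exp (-2 ^ D) :=
      mul_le_of_le_one_left (Real.exp_nonneg _) ((div_le_one (by positivity)).2 pow_le)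

end ManyHop

open ManyHop in
theorem corollary2_general {p : unitInterval} (hp : (p : ℝ) < 1 / 2) :
    ∃ r : ℕ, 0 < r ∧ ∃ C : ℝ, 0 < C ∧ ∃ M : ℕ, ∀ m k : ℕ, M ≤ m →
      (transmissionTime r m k : ℝ) ≤ C * (m + k) ∧
      ∀ w : Fin k → Bool, (multiBit r m k).errorProb p m w ≤
        Real.exp (-((transmissionTime r m k : ℝ) ^
          ((1 / 32 : ℝ) / Real.log (Real.log (transmissionTime r m k))))) := by
  obtain ⟨r, hr, voteFails_le⟩ := exists_repetitions hp
  obtain ⟨C, hC, time_le⟩ := exists_transmissionTime_le r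
  refine ⟨r, hr, C, hC, 10 + 3 * r + ⌈Real.exp (Real.exp 1)⌉₊, fun m k hm =>
    ⟨time_le m k (by omega), fun w => ?_⟩⟩
  have one_le_level : 1 ≤ endLevel m k := one_le_endLevel (by omega) k
  have exp_exp_le : Real.exp (Real.exp 1) ≤ transmissionTime r m k := by
    have := le_transmissionTime_add_one hr m k
    exact (Nat.le_ceil _).trans
      (mod_cast (by omega : ⌈Real.exp (Real.exp 1)⌉₊ ≤ transmissionTime r m k))
  have time_le_pow : (transmissionTime r m k : ℝ) ≤
      ((endLevel m k : ℝ) + 3) ^ (4 * (endLevel m k + 3)) :=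
    mod_cast transmissionTime_le_pow (by omega) k
  calc (multiBit r m k).errorProb p m w
      ≤ numBlocks m k * (tSeq (endLevel m k + 1) * failBound (endLevel m k)) :=
        errorProb_multiBit_le (by omega) (voteFails_le m _) one_le_level w
    _ ≤ Real.exp (-2 ^ endLevel m k) := numBlocks_mul_failBound_le m k
    _ ≤ _ := Real.exp_le_exp.2 (neg_le_neg (rpow_le_two_pow one_le_level exp_exp_le time_le_pow))

theorem corollary2 (p : unitInterval) (hp0 : 0 < (p : ℝ)) (hp : (p : ℝ) < 1 / 2) :
    ∃ r : ℕ, 0 < r ∧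
      ∀ α β : ℝ, 0 < α → α ≤ β →
        ∃ C c : ℝ, 0 < C ∧ 0 < c ∧ ∃ M : ℕ, ∀ m k : ℕ, M ≤ m →
          α * (m : ℝ) ≤ (k : ℝ) → (k : ℝ) ≤ β * (m : ℝ) →
          (ManyHop.transmissionTime r m k : ℝ) ≤ C * (m : ℝ) ∧
          ∀ w : Fin k → Bool,
            (ManyHop.multiBit r m k).errorProb p m w ≤
              Real.exp (-((ManyHop.transmissionTime r m k : ℝ) ^
                (c / Real.log (Real.log (ManyHop.transmissionTime r m k : ℝ))))) := by
  obtain ⟨r, hr, C, hC, M, bounds⟩ := corollary2_general hp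
  refine ⟨r, hr, fun α β hα hαβ => ⟨C * (1 + β), 1 / 32, mul_pos hC (by linarith), by norm_num,
    M, fun m k hm _ hk => ⟨?_, (bounds m k hm).2⟩⟩⟩
  calc _ ≤ C * (m + k) := (bounds m k hm).1
    _ ≤ C * (1 + β) * m := by rw [mul_assoc]; gcongr; linarith
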